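/- Let $(\bar M,\langle\cdot,\cdot\rangle)$ be a smooth oriented $8$-dimensional pseudo-Riemannian manifold of signature $(4,4)$ with a smooth $3$-fold vector cross product $X$: a smooth $(1,3)$-tensor field such that, for all $w_1,w_2,w_3\in T_x\bar M$, \[\langle X(w_1,w_2,w_3),w_i\rangle=0\quad(i=1,2,3),\qquad \langle X(w_1,w_2,w_3),X(w_1,w_2,w_3)\rangle=\det(\langle w_i,w_j\rangle).\] Let $\mu$ be the $4$-form $\mu(v_1,v_2,v_3,v_4)=\langle X(v_1,v_2,v_3),v_4\rangle$ on $\bar M$. Let $M$ be a smooth oriented $6$-manifold and $i:M\to\bar M$ a smooth immersion such that the restriction of $\langle\cdot,\cdot\rangle$ to the normal bundle of $M$ has signature $(1,1)$ at every point. Orient the normal spaces so that a basis $\{a,b\}$ of $T_pM^\perp$ is positive if and only if $\{a,b,di(e_1),\dots,di(e_6)\}$ is a positive basis of $T_{i(p)}\bar M$ for a positive basis $\{e_1,\dots,e_6\}$ of $T_pM$. Let $L$ be the induced almost paracomplex structure on $M$: identifying $T_pM$ with its image in $T_{i(p)}\bar M$, $L_p(v)=-X(a,b,v)$, where $\{a,b\}$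 is any positively oriented orthogonal basis of $T_pM^\perp$ with $\langle a,a\rangle,\langle b,b\rangle\in\{1,-1\}$. Let $g=i^*\langle\cdot,\cdot\rangle$ be the pullback metric and let $\omega(v,w)=g(Lv,w)$ be the para-Hermitian form on $M$. If $X$ is semi-parallel, i.e. $\delta\mu=0$, where $\delta$ is the codifferential of $(\bar M,\langle\cdot,\cdot\rangle)$, then $\omega$ is coclosed, i.e. $\delta\omega=0$, where $\delta$ is the codifferential of $(M,g)$. -/

import Mathlib

open Bundle Module
open scoped Manifold ContDiff

noncomputable section

namespace ParaGray

/-! ### Linear algebra -/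

section LinearAlgebra

variable {V W : Type*} [AddCommGroup V] [Module ℝ V] [AddCommGroup W] [Module ℝ W]

/-- The symmetric bilinear form `B` has signature `(p, q)`: the maximal dimensions of a positive
definite and of a negative definite subspace are `p` and `q`, and `p + q` is the dimension. -/
def HasSignature (B : LinearMap.BilinForm ℝ W) (p q : ℕ) : Prop :=
  sigPos B.toQuadraticMap = p ∧ sigNeg B.toQuadraticMap = q ∧ finrank ℝ W = p + q

/-- `X` is an `r`-fold vector cross product on `(W, B)`:
`⟨X(w₁, …, w_r), wᵢ⟩ = 0` and `⟨X(w₁, …, w_r), X(w₁, …, w_r)⟩ = det ⟨wᵢ, wⱼ⟩`. -/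
structure IsVectorCrossProduct {r : ℕ} (B : LinearMap.BilinForm ℝ W)
    (X : MultilinearMap ℝ (fun _ : Fin r => W) W) : Prop where
  inner_eq_zero : ∀ (w : Fin r → W) (i : Fin r), B (X w) (w i) = 0
  inner_self : ∀ w : Fin r → W, B (X w) (X w) = (Matrix.of fun i j => B (w i) (w j)).det

/-- The normal space of the image of `d : V → W`. -/
def normalSpace (B : LinearMap.BilinForm ℝ W) (d : V →ₗ[ℝ] W) : Submodule ℝ W :=
  B.orthogonal (LinearMap.range d)

/-- `{a, b}` is a positively oriented orthogonal basis, with `⟨a, a⟩, ⟨b, b⟩ = ± 1`, of the normal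
space of the image of `d : V → W`. Here the normal space carries the orientation for which a basis
`{a, b}` is positive if and only if `{a, b, d e₁, …, d e₆}` is a positive basis of `W` for a
positive basis `{e₁, …, e₆}` of `V`. -/
structure IsOrientedNormalFrame (B : LinearMap.BilinForm ℝ W) (d : V →ₗ[ℝ] W)
    (oV : Orientation ℝ V (Fin 6)) (oW : Orientation ℝ W (Fin 8)) (a b : W) : Prop where
  left_mem : a ∈ normalSpace B d
  right_mem : b ∈ normalSpace B d
  left_self : B a a = 1 ∨ B a a = -1
  right_self : B b b = 1 ∨ B b b = -1
  inner_eq_zero : B a b = 0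
  oriented : ∃ (e : Basis (Fin 6) ℝ V) (E : Basis (Fin 8) ℝ W),
    e.orientation = oV ∧ E.orientation = oW ∧
      ⇑E = Matrix.vecCons a (Matrix.vecCons b (⇑d ∘ ⇑e))

theorem mem_normalSpace {B : LinearMap.BilinForm ℝ W} (hB : ∀ v w, B v w = B w v)
    {d : V →ₗ[ℝ] W} {n : W} : n ∈ normalSpace B d ↔ ∀ v, B n (d v) = 0 := by
  simp only [normalSpace, LinearMap.BilinForm.mem_orthogonal_iff, LinearMap.mem_range,
    forall_exists_index, forall_apply_eq_imp_iff]
  exact forall_congr' fun v => by rw [hB n]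

/-- A plane of signature `(1, 1)` has an orthonormal basis. -/
theorem exists_orthonormal {B : LinearMap.BilinForm ℝ W} (hB : ∀ v w, B v w = B w v)
    {N : Submodule ℝ W} (hN : HasSignature (B.restrict N) 1 1) :
    ∃ a ∈ N, ∃ b ∈ N, B a a = 1 ∧ B b b = -1 ∧ B a b = 0 := by
  obtain ⟨hp, hm, hd⟩ := hN
  have : Module.Finite ℝ N := Module.finite_of_finrank_pos (by omega)
  obtain ⟨P, hP, hPd⟩ := exists_finrank_eq_sigPos_and_posDef (B.restrict N).toQuadraticMap
  obtain ⟨M, hM, hMd⟩ := exists_finrank_eq_sigNeg_and_negDef (B.restrict N).toQuadraticMap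
  have hP' : 0 < finrank ℝ P := by omega
  have hM' : 0 < finrank ℝ M := by omega
  obtain ⟨x, hx⟩ := finrank_pos_iff_exists_ne_zero.1 hP'
  obtain ⟨y, hy⟩ := finrank_pos_iff_exists_ne_zero.1 hM'
  have hxx : 0 < B x x := by simpa using hPd x hx
  have hyy : B y y < 0 := by simpa using hMd y hy
  set s := Real.sqrt (B x x) with hs
  have hs0 : 0 < s := Real.sqrt_pos.2 hxx
  have hss : s * s = B x x := Real.mul_self_sqrt hxx.le
  set a : W := s⁻¹ • (x : W) with ha
  have haa : B a a = 1 := by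
    simp only [ha, map_smul, LinearMap.smul_apply, smul_eq_mul, ← hss]
    field_simp
  set z : W := (y : W) - B a y • a with hz
  have haz : B a z = 0 := by simp [hz, haa]
  have hzz : B z z < 0 := by
    have : B z z = B y y - B a y * B a y := by
      simp only [hz, map_sub, map_smul, LinearMap.sub_apply, LinearMap.smul_apply, smul_eq_mul,
        haa, hB (y : W) a]
      ring
    rw [this]
    nlinarith [mul_self_nonneg (B a y)]
  have haN : a ∈ N := N.smul_mem _ x.1.2
  have hzN : z ∈ N := N.sub_mem y.1.2 (N.smul_mem _ haN)
  set t := Real.sqrt (-(B z z)) with ht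
  have ht0 : 0 < t := Real.sqrt_pos.2 (by linarith)
  have htt : t * t = -(B z z) := Real.mul_self_sqrt (by linarith)
  refine ⟨a, haN, t⁻¹ • z, N.smul_mem _ hzN, haa, ?_, ?_⟩
  · have : B z z = -(t * t) := by linarith
    simp only [map_smul, LinearMap.smul_apply, smul_eq_mul, this]
    field_simp
  · simp [haz]

theorem exists_isOrientedNormalFrame {B : LinearMap.BilinForm ℝ W} (hB : ∀ v w, B v w = B w v)
    {d : V →ₗ[ℝ] W} (hd : Function.Injective d) (hV : finrank ℝ V = 6) (hW : finrank ℝ W = 8)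
    (hN : HasSignature (B.restrict (normalSpace B d)) 1 1)
    (oV : Orientation ℝ V (Fin 6)) (oW : Orientation ℝ W (Fin 8)) :
    ∃ a b, IsOrientedNormalFrame B d oV oW a b := by
  obtain ⟨a, ha, b, hb, haa, hbb, hab⟩ := exists_orthonormal hB hN
  have : Module.Finite ℝ V := Module.finite_of_finrank_pos (by omega)
  have : Module.Finite ℝ W := Module.finite_of_finrank_pos (by omega)
  set e : Basis (Fin 6) ℝ V := oV.someBasis (by simp [hV]) with he
  have heo : e.orientation = oV := oV.someBasis_orientation _
  have key : ∀ c ∈ normalSpace B d, B c c = -1 → B a c = 0 →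
      ∃ E : Basis (Fin 8) ℝ W, ⇑E = Matrix.vecCons a (Matrix.vecCons c (⇑d ∘ ⇑e)) := by
    intro c hc hcc hac
    have hc' := (mem_normalSpace hB).1 hc
    have ha' := (mem_normalSpace hB).1 ha
    have hspan : ∀ n : W, (∀ v, B n (d v) = 0) →
        Submodule.span ℝ (Set.range (⇑d ∘ ⇑e)) ≤ LinearMap.ker (B n) := by
      intro n hn
      rw [Submodule.span_le]
      rintro _ ⟨i, rfl⟩
      exact hn _
    have h1 : LinearIndependent ℝ (⇑d ∘ ⇑e) :=
      e.linearIndependent.map' d (LinearMap.ker_eq_bot.2 hd)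
    have h2 : LinearIndependent ℝ (Matrix.vecCons c (⇑d ∘ ⇑e)) := by
      refine linearIndependent_finCons.2 ⟨h1, fun h => ?_⟩
      have := LinearMap.mem_ker.1 (hspan c hc' h)
      rw [hcc] at this
      norm_num at this
    have h3 : LinearIndependent ℝ (Matrix.vecCons a (Matrix.vecCons c (⇑d ∘ ⇑e))) := by
      refine linearIndependent_finCons.2 ⟨h2, fun h => ?_⟩
      have hle : Submodule.span ℝ (Set.range (Matrix.vecCons c (⇑d ∘ ⇑e))) ≤
          LinearMap.ker (B a) := by
        rw [Submodule.span_le]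
        rintro _ ⟨i, rfl⟩
        refine Fin.cases ?_ (fun j => ?_) i
        · simpa using hac
        · simpa using ha' (e j)
      have := LinearMap.mem_ker.1 (hle h)
      rw [haa] at this
      norm_num at this
    exact ⟨basisOfLinearIndependentOfCardEqFinrank h3 (by simp [hW]), by simp⟩
  obtain ⟨E, hE⟩ := key b hb hbb hab
  rcases E.orientation_eq_or_eq_neg oW with h | h
  · exact ⟨a, b, ha, hb, Or.inl haa, Or.inr hbb, hab, e, E, heo, h.symm, hE⟩
  · refine ⟨a, -b, ha, Submodule.neg_mem _ hb, Or.inl haa, Or.inr (by simpa using hbb),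
      by simpa using hab, e, E.unitsSMul (Function.update 1 1 (-1)), heo, ?_, ?_⟩
    · rw [Basis.orientation_neg_single, h]
    · funext i
      rw [Basis.unitsSMul_apply, hE]
      refine Fin.cases ?_ (fun j => Fin.cases ?_ (fun k => ?_) j) i
      · simp
      · simp [Function.update]
      · have : (k.succ.succ : Fin 8) ≠ 1 := by
          intro h
          have := congrArg Fin.val h
          simp only [Fin.val_succ, Fin.val_one] at this
          omega
        simp [Function.update_of_ne this]

/-- The endomorphism `v ↦ - X(a, b, v)` of the tangent space, for an oriented orthonormal
basis `{a, b}` of the normal space. -/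
theorem exists_paracomplex {B : LinearMap.BilinForm ℝ W} (hB : ∀ v w, B v w = B w v)
    {d : V →ₗ[ℝ] W} (hd : Function.Injective d) (hV : finrank ℝ V = 6) (hW : finrank ℝ W = 8)
    (hN : HasSignature (B.restrict (normalSpace B d)) 1 1)
    (oV : Orientation ℝ V (Fin 6)) (oW : Orientation ℝ W (Fin 8))
    (X : MultilinearMap ℝ (fun _ : Fin 3 => W) W) (hX : IsVectorCrossProduct B X) :
    ∃ L : V →ₗ[ℝ] V, ∃ a b, IsOrientedNormalFrame B d oV oW a b ∧
      ∀ v, d (L v) = -X ![a, b, d v] := by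
  obtain ⟨a, b, h⟩ := exists_isOrientedNormalFrame hB hd hV hW hN oV oW
  let Y : W →ₗ[ℝ] W := X.toLinearMap ![a, b, 0] 2
  have hY : ∀ w, Y w = X ![a, b, w] := fun w => by
    simp only [Y, MultilinearMap.toLinearMap_apply]
    congr 1
    funext i
    fin_cases i <;> simp [Function.update]
  have hmem : ∀ v, (-(Y ∘ₗ d)) v ∈ LinearMap.range d := by
    intro v
    obtain ⟨e, E, -, -, hE⟩ := h.oriented
    have ha' := (mem_normalSpace hB).1 h.left_mem
    have hb' := (mem_normalSpace hB).1 h.right_mem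
    set x : W := (-(Y ∘ₗ d)) v with hx
    have hxa : B x a = 0 := by
      simpa [hx, hY] using hX.inner_eq_zero ![a, b, d v] 0
    have hxb : B x b = 0 := by
      simpa [hx, hY] using hX.inner_eq_zero ![a, b, d v] 1
    have hsum := E.sum_repr x
    rw [Fin.sum_univ_succ, Fin.sum_univ_succ, hE] at hsum
    simp only [Matrix.cons_val_zero, Matrix.cons_val_succ, Function.comp_apply] at hsum
    set α := E.repr x 0
    set β := E.repr x (Fin.succ 0)
    have hsum' : α • a + (β • b + d (∑ i : Fin 6, E.repr x i.succ.succ • e i)) = x := by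
      rw [map_sum]
      simpa using hsum
    set u := ∑ i : Fin 6, E.repr x i.succ.succ • e i
    have hα : α = 0 := by
      have := hxa
      rw [← hsum', hB] at this
      simp only [map_add, map_smul, smul_eq_mul, h.inner_eq_zero, ha'] at this
      rcases h.left_self with h0 | h0 <;> simpa [h0] using this
    have hβ : β = 0 := by
      have := hxb
      rw [← hsum', hB] at this
      simp only [map_add, map_smul, smul_eq_mul, hB b a, h.inner_eq_zero, hb'] at this
      rcases h.right_self with h0 | h0 <;> simpa [h0] using this
    exact ⟨u, by simpa [hα, hβ] using hsum'⟩
  refine ⟨(LinearEquiv.ofInjective d hd).symm.toLinearMap ∘ₗ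
    (-(Y ∘ₗ d)).codRestrict _ hmem, a, b, h, fun v => ?_⟩
  simp [hY]

/-- The `(r + 1)`-form `μ(v₁, …, v_{r+1}) = ⟨X(v₁, …, v_r), v_{r+1}⟩` of a vector cross product. -/
def crossProductForm {r : ℕ} {B : LinearMap.BilinForm ℝ W}
    {X : MultilinearMap ℝ (fun _ : Fin r => W) W} (hX : IsVectorCrossProduct B X) :
    W [⋀^Fin (r + 1)]→ₗ[ℝ] ℝ where
  toMultilinearMap := MultilinearMap.uncurryRight (M := fun _ => W) (B.compMultilinearMap X)
  map_eq_zero_of_eq' := by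
    have main : ∀ (v : Fin (r + 1) → W) (i j : Fin r), v i.castSucc = v j.castSucc → i ≠ j →
        B (X (Fin.init v)) (v (Fin.last r)) = 0 := by
      intro v i j hv hij
      set w : Fin r → W := Fin.init v
      set z := v (Fin.last r)
      have hw : w i = w j := hv
      have h1 := hX.inner_eq_zero (Function.update w i (w i + z)) i
      have h2 := hX.inner_eq_zero (Function.update w i z) i
      have h3 := hX.inner_eq_zero (Function.update w i z) j
      have h4 := hX.inner_eq_zero w i
      rw [Function.update_of_ne hij.symm, ← hw] at h3
      simp only [X.map_update_add, Function.update_self, Function.update_eq_self, map_add,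
        LinearMap.add_apply] at h1 h2
      linarith
    have last : ∀ (v : Fin (r + 1) → W) (i : Fin r), v i.castSucc = v (Fin.last r) →
        B (X (Fin.init v)) (v (Fin.last r)) = 0 := by
      intro v i hv
      rw [← hv]
      exact hX.inner_eq_zero (Fin.init v) i
    intro v i j hv hij
    change B (X (Fin.init v)) (v (Fin.last r)) = 0
    induction i using Fin.lastCases with
    | last =>
      induction j using Fin.lastCases with
      | last => exact absurd rfl hij
      | cast j => exact last v j hv.symm
    | cast i =>
      induction j using Fin.lastCases with
      | last => exact last v i hv
      | cast j => exact main v i j hv (fun h => hij (by rw [h]))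

end LinearAlgebra

section Continuity

variable {V : Type*} [AddCommGroup V] [Module ℝ V] [TopologicalSpace V] [IsTopologicalAddGroup V]
  [ContinuousSMul ℝ V] [T2Space V] [FiniteDimensional ℝ V]

theorem continuous_multilinear {k : ℕ} (f : MultilinearMap ℝ (fun _ : Fin k => V) ℝ) :
    Continuous f := by
  set b := finBasis ℝ V
  have h : ∀ v : Fin k → V, f v =
      ∑ r : Fin k → Fin (finrank ℝ V), (∏ i, b.coord (r i) (v i)) * f fun i => b (r i) := by
    intro v
    conv_lhs => rw [show v = fun i => ∑ j, b.repr (v i) j • b j from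
      funext fun i => (b.sum_repr (v i)).symm]
    rw [f.map_sum]
    refine Finset.sum_congr rfl fun r _ => ?_
    rw [f.map_smul_univ]
    rfl
  rw [show (f : (Fin k → V) → ℝ) = _ from funext h]
  have hc : ∀ j, Continuous (b.coord j) := fun j => LinearMap.continuous_of_finiteDimensional _
  fun_prop

/-- Alternating forms on a finite-dimensional space are continuous. -/
def toContinuousAlternating {k : ℕ} (f : V [⋀^Fin k]→ₗ[ℝ] ℝ) : V [⋀^Fin k]→L[ℝ] ℝ :=
  { f with cont := continuous_multilinear f.toMultilinearMap }

end Continuity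

/-! ### Differential forms, the Levi-Civita connection and the codifferential -/

section Manifold

/-- Coordinate space. -/
abbrev Coord (n : ℕ) : Type := EuclideanSpace ℝ (Fin n)

variable {n : ℕ} {M : Type*} [TopologicalSpace M] [ChartedSpace (Coord n) M]

theorem finrank_tangentSpace (x : M) : finrank ℝ (TangentSpace (𝓡 n) x) = n :=
  finrank_euclideanSpace_fin (𝕜 := ℝ)

instance (x : M) : FiniteDimensional ℝ (TangentSpace (𝓡 n) x) :=
  inferInstanceAs (FiniteDimensional ℝ (Coord n))

instance (x : M) : T2Space (TangentSpace (𝓡 n) x) :=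
  inferInstanceAs (T2Space (Coord n))

variable (n M) in
/-- A field of bilinear forms on the tangent spaces of `M`. -/
abbrev BilinField : Type _ :=
  ∀ x : M, TangentSpace (𝓡 n) x →L[ℝ] TangentSpace (𝓡 n) x →L[ℝ] ℝ

variable (n M) in
/-- A field of alternating `k`-forms on the tangent spaces of `M`. -/
abbrev FormField (k : ℕ) : Type _ :=
  ∀ x : M, TangentSpace (𝓡 n) x [⋀^Fin k]→L[ℝ] ℝ

variable (n M) in
/-- A pseudo-Riemannian metric: a smooth field of nondegenerate symmetric bilinear forms. -/
structure PseudoRiemannianMetric [IsManifold (𝓡 n) ∞ M] where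
  val : BilinField n M
  symm : ∀ (x : M) (v w : TangentSpace (𝓡 n) x), val x v w = val x w v
  nondegenerate : ∀ (x : M) (v : TangentSpace (𝓡 n) x), (∀ w, val x v w = 0) → v = 0
  contMDiff : ContMDiff (𝓡 n) ((𝓡 n).prod 𝓘(ℝ, Coord n →L[ℝ] Coord n →L[ℝ] ℝ)) ∞
    (fun x => TotalSpace.mk' (Coord n →L[ℝ] Coord n →L[ℝ] ℝ) x (val x))

variable (n M) in
/-- An orientation of a manifold: a choice of an orientation of every tangent space which is
locally constant in the coordinate trivializations of the tangent bundle. -/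
structure ManifoldOrientation [IsManifold (𝓡 n) ∞ M] where
  toFun : ∀ x : M, Orientation ℝ (TangentSpace (𝓡 n) x) (Fin n)
  locally_constant : ∀ x₀ : M, ∃ o : Orientation ℝ (Coord n) (Fin n), ∀ᶠ x in nhds x₀,
    ∀ hx : x ∈ (trivializationAt (Coord n) (TangentSpace (𝓡 n)) x₀).baseSet,
      Orientation.map (Fin n) ((trivializationAt (Coord n) (TangentSpace (𝓡 n))
        x₀).continuousLinearEquivAt ℝ x hx).toLinearEquiv (toFun x) = o

variable [IsManifold (𝓡 n) ∞ M]

/-- The linear map `ℝⁿ → T_x M` which sends the standard basis to the coordinate frame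
`∂₁, …, ∂ₙ` of the preferred chart at `x₀` (for `x` in the domain of that chart). -/
def coordFrame (x₀ x : M) : Coord n →L[ℝ] TangentSpace (𝓡 n) x :=
  (trivializationAt (Coord n) (TangentSpace (𝓡 n)) x₀).symmL ℝ x

/-- The components `g(∂ᵢ, ∂ⱼ)` of `g` in the preferred chart at `x₀`, as a function of the
coordinates. -/
def metricInChart (g : BilinField n M) (x₀ : M) (y : Coord n) : Coord n →L[ℝ] Coord n →L[ℝ] ℝ :=
  let x := (extChartAt (𝓡 n) x₀).symm y
  ((coordFrame x₀ x).precomp ℝ).comp ((g x).comp (coordFrame x₀ x))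

/-- The components of the form `α` in the preferred chart at `x₀`, as a function of the
coordinates. -/
def formInChart {k : ℕ} (α : FormField n M k) (x₀ : M) (y : Coord n) :
    Coord n [⋀^Fin k]→L[ℝ] ℝ :=
  let x := (extChartAt (𝓡 n) x₀).symm y
  (α x).compContinuousLinearMap (coordFrame x₀ x)

/-- The inverse metric `(ℝⁿ)* → ℝⁿ` (raising an index) at the point with coordinates `y`. -/
def sharp (G : Coord n → Coord n →L[ℝ] Coord n →L[ℝ] ℝ) (y : Coord n) :
    (Coord n →L[ℝ] ℝ) →L[ℝ] Coord n :=
  (G y).inverse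

/-- The Christoffel symbols `Γ(u, v) = ∇_u v` (`u`, `v` constant in coordinates) of the Levi-Civita
connection: `⟨Γ(u, v), z⟩ = ½ (∂_u ⟨v, z⟩ + ∂_v ⟨u, z⟩ - ∂_z ⟨u, v⟩)` for all `z`. -/
def christoffel (G : Coord n → Coord n →L[ℝ] Coord n →L[ℝ] ℝ) (y u v : Coord n) : Coord n :=
  sharp G y ((1 / 2 : ℝ) •
    (fderiv ℝ G y u v + fderiv ℝ G y v u - ((fderiv ℝ G y).flip u).flip v))

/-- The covariant derivative `(∇_u A)(w₁, …, w_k)` of a `k`-form in coordinates with respect to the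
Levi-Civita connection of the metric `G`. -/
def covDeriv {k : ℕ} (G : Coord n → Coord n →L[ℝ] Coord n →L[ℝ] ℝ)
    (A : Coord n → Coord n [⋀^Fin k]→L[ℝ] ℝ) (y u : Coord n) (w : Fin k → Coord n) : ℝ :=
  fderiv ℝ A y u w - ∑ j, A y (Function.update w j (christoffel G y u (w j)))

/-- The codifferential with respect to the metric `g`,
`(δα)(v₁, …, v_k) = - ∑ᵢⱼ gⁱʲ (∇_{∂ᵢ} α)(∂ⱼ, v₁, …, v_k)`, computed at `x` in the preferred chart
at `x`. -/
def codifferential (g : BilinField n M) {k : ℕ} (α : FormField n M (k + 1)) (x : M)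
    (v : Fin k → TangentSpace (𝓡 n) x) : ℝ :=
  let G := metricInChart g x
  let y := extChartAt (𝓡 n) x x;
  -∑ i : Fin n, covDeriv G (formInChart α x) y (EuclideanSpace.single i 1)
    (Fin.cons (sharp G y (EuclideanSpace.proj i)) fun j =>
      (trivializationAt (Coord n) (TangentSpace (𝓡 n)) x).continuousLinearMapAt ℝ x (v j))

/-- `δα = 0` with respect to the metric `g`. -/
def IsCoclosed (g : BilinField n M) {k : ℕ} (α : FormField n M (k + 1)) : Prop :=
  ∀ (x : M) (v : Fin k → TangentSpace (𝓡 n) x), codifferential g α x v = 0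

namespace PseudoRiemannianMetric

/-- The metric at a point as a bilinear form in the algebraic sense. -/
def bilin (h : PseudoRiemannianMetric n M) (x : M) :
    LinearMap.BilinForm ℝ (TangentSpace (𝓡 n) x) :=
  (h.val x).toBilinForm

end PseudoRiemannianMetric

/-! ### Vector cross products on manifolds -/

/-- An `r`-fold vector cross product on a pseudo-Riemannian manifold: a smooth `(1, r)`-tensor field
which is an `r`-fold vector cross product on every tangent space. A tensor field is smooth if
it maps the coordinate vector fields of every chart to smooth vector fields. -/
structure VectorCrossProduct (r : ℕ) (h : PseudoRiemannianMetric n M) where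
  toFun : ∀ x : M,
    MultilinearMap ℝ (fun _ : Fin r => TangentSpace (𝓡 n) x) (TangentSpace (𝓡 n) x)
  contMDiffOn : ∀ (x₀ : M) (u : Fin r → Coord n),
    ContMDiffOn (𝓡 n) ((𝓡 n).prod 𝓘(ℝ, Coord n)) ∞
      (fun x => (⟨x, toFun x fun i => coordFrame x₀ x (u i)⟩ : TangentBundle (𝓡 n) M))
      (chartAt (Coord n) x₀).source
  isVectorCrossProduct : ∀ x : M, IsVectorCrossProduct (h.bilin x) (toFun x)

/-- The `(r + 1)`-form `μ(v₁, …, v_{r+1}) = ⟨X(v₁, …, v_r), v_{r+1}⟩` on the manifold. -/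
def VectorCrossProduct.form {r : ℕ} {h : PseudoRiemannianMetric n M}
    (X : VectorCrossProduct r h) : FormField n M (r + 1) :=
  fun x => toContinuousAlternating (crossProductForm (X.isVectorCrossProduct x))

/-- The vector cross product `X` is semi-parallel: `δμ = 0`. -/
def VectorCrossProduct.IsSemiParallel {r : ℕ} {h : PseudoRiemannianMetric n M}
    (X : VectorCrossProduct r h) : Prop :=
  IsCoclosed h.val X.form

end Manifold

/-! ### The induced almost paracomplex structure -/

section Immersion

variable {M : Type*} [TopologicalSpace M] [ChartedSpace (Coord 6) M] [IsManifold (𝓡 6) ∞ M]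
  {N : Type*} [TopologicalSpace N] [ChartedSpace (Coord 8) N] [IsManifold (𝓡 8) ∞ N]

/-- The differential of `f` at `p`. -/
def differential (f : M → N) (p : M) :
    TangentSpace (𝓡 6) p →L[ℝ] TangentSpace (𝓡 8) (f p) :=
  mfderiv (𝓡 6) (𝓡 8) f p

/-- `f` is an immersion into a pseudo-Riemannian manifold whose normal bundle has signature
`(1, 1)`. -/
structure IsLorentzNormalImmersion (h : PseudoRiemannianMetric 8 N) (f : M → N) : Prop where
  contMDiff : ContMDiff (𝓡 6) (𝓡 8) ∞ f
  injective : ∀ p, Function.Injective (differential f p)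
  signature : ∀ p, HasSignature
    ((h.bilin (f p)).restrict (normalSpace (h.bilin (f p)) (differential f p).toLinearMap)) 1 1

/-- The pullback metric. -/
def pullbackMetric (h : PseudoRiemannianMetric 8 N) (f : M → N) : BilinField 6 M := fun p =>
  ((differential f p).precomp ℝ).comp ((h.val (f p)).comp (differential f p))

variable {h : PseudoRiemannianMetric 8 N} {f : M → N}

theorem exists_paracomplexStructure (X : VectorCrossProduct 3 h) (oM : ManifoldOrientation 6 M)
    (oN : ManifoldOrientation 8 N) (hf : IsLorentzNormalImmersion h f) (p : M) :
    ∃ L : TangentSpace (𝓡 6) p →ₗ[ℝ] TangentSpace (𝓡 6) p, ∃ a b,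
      IsOrientedNormalFrame (h.bilin (f p)) (differential f p).toLinearMap
        (oM.toFun p) (oN.toFun (f p)) a b ∧
      ∀ v, differential f p (L v) = -X.toFun (f p) ![a, b, differential f p v] :=
  exists_paracomplex (B := h.bilin (f p)) (d := (differential f p).toLinearMap)
    (h.symm (f p)) (hf.injective p) (finrank_tangentSpace p)
    (finrank_tangentSpace (f p)) (hf.signature p) (oM.toFun p) (oN.toFun (f p))
    (X.toFun (f p)) (X.isVectorCrossProduct (f p))

/-- The almost paracomplex structure `L_p(v) = -X(a, b, v)` on `M`, where `{a, b}` is an oriented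
orthogonal basis of the normal space at `p` with `⟨a, a⟩, ⟨b, b⟩ = ± 1` (any two such bases have
the same bivector `a ∧ b`, so that `L_p` does not depend on the choice). -/
def paracomplexStructure (X : VectorCrossProduct 3 h) (oM : ManifoldOrientation 6 M)
    (oN : ManifoldOrientation 8 N) (hf : IsLorentzNormalImmersion h f) (p : M) :
    TangentSpace (𝓡 6) p →ₗ[ℝ] TangentSpace (𝓡 6) p :=
  (exists_paracomplexStructure X oM oN hf p).choose

theorem paracomplexStructure_spec (X : VectorCrossProduct 3 h) (oM : ManifoldOrientation 6 M)
    (oN : ManifoldOrientation 8 N) (hf : IsLorentzNormalImmersion h f) (p : M) : ∃ a b,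
      IsOrientedNormalFrame (h.bilin (f p)) (differential f p).toLinearMap
        (oM.toFun p) (oN.toFun (f p)) a b ∧
      ∀ v, differential f p (paracomplexStructure X oM oN hf p v) =
        -X.toFun (f p) ![a, b, differential f p v] :=
  (exists_paracomplexStructure X oM oN hf p).choose_spec

/-- The para-Hermitian form `ω(v, w) = ⟨L v, w⟩` on `M`. -/
def paraHermitianForm (X : VectorCrossProduct 3 h) (oM : ManifoldOrientation 6 M)
    (oN : ManifoldOrientation 8 N) (hf : IsLorentzNormalImmersion h f) : FormField 6 M 2 :=
  fun p => toContinuousAlternating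
  { toFun := fun v =>
      pullbackMetric h f p (paracomplexStructure X oM oN hf p (v 0)) (v 1)
    map_update_add' := by
      intro _ v i a b
      fin_cases i <;> simp
    map_update_smul' := by
      intro _ v i a b
      fin_cases i <;> simp
    map_eq_zero_of_eq' := by
      have key : ∀ v, pullbackMetric h f p (paracomplexStructure X oM oN hf p v) v = 0 := by
        intro v
        obtain ⟨a, b, -, hL⟩ := paracomplexStructure_spec X oM oN hf p
        have := (X.isVectorCrossProduct (f p)).inner_eq_zero ![a, b, differential f p v] 2
        change h.val (f p) (differential f p (paracomplexStructure X oM oN hf p v))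
          (differential f p v) = 0
        rw [hL, map_neg]
        change -(h.bilin (f p) (X.toFun (f p) ![a, b, differential f p v])
          (differential f p v)) = 0
        rw [neg_eq_zero]
        exact this
      intro v i j hv hij
      fin_cases i <;> fin_cases j
      · exact absurd rfl hij
      · have hv' : v 0 = v 1 := hv
        rw [hv']
        exact key _
      · have hv' : v 1 = v 0 := hv
        rw [hv']
        exact key _
      · exact absurd rfl hij }

end Immersion

end ParaGray

end

noncomputable section

namespace ParaGray

/-! Near a point, `ω` is the restriction of `-μ(a, b, ·, ·)` for a differentiable, positively
oriented normal frame with Gram determinant `±1`. The frames chosen pointwise in the definition of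
`L` do not matter: two such frames differ by a positive determinant whose fourth power is `1`, so
they have the same bivector (`form_eq_of_frames`). Only the bivector enters, so a frame with
constant Gram determinant that is orthonormal at the one point under study is enough
(`exists_isNormalFrameAt`, `exists_normalFrame_form_eq`).

Differentiate this expression with the ambient connection and split into tangential and normal
parts. For the two tangent arguments, the tangential parts reproduce the induced connection (Gauss),
while the normal parts are combinations of `a` and `b` and are killed by alternation. The normal
parts of `∇a` and `∇b` contribute a multiple of `ω` whose coefficient is half the logarithmic
derivative of the Gram determinant, hence zero. With `S_a`, `S_b` the tangential parts of `∇a`,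
`∇b`, what remains is (`covDeriv_form`) `(∇_u ω)(v, w) = -(∇_u μ)(a, b, v, w) - μ(S_a u, b, v, w) -
μ(a, S_b u, v, w)`.

Now trace over `u` and `v`. The operators `S_a`, `S_b` are self-adjoint and `μ` is skew, so the last
two terms have trace zero (`IsInverseFamily.sum_skew`). In the first term the induced trace may be
replaced by the ambient one, because the missing normal terms `(∇_a μ)(a, b, a, w)` and `(∇_b μ)(a,
b, b, w)` vanish by alternation; the ambient trace is `δμ(a, b, w)` up to sign, which is zero
(`sum_covDeriv_form`). The rest carries this computation between charts and manifolds. -/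

instance (n : ℕ) : NormedAddCommGroup (Coord n →L[ℝ] ℝ) := inferInstance
instance (n : ℕ) : NormedSpace ℝ (Coord n →L[ℝ] ℝ) := inferInstance
instance (n : ℕ) : NormedAddCommGroup (Coord n →L[ℝ] Coord n →L[ℝ] ℝ) := inferInstance
instance (n : ℕ) : NormedSpace ℝ (Coord n →L[ℝ] Coord n →L[ℝ] ℝ) := inferInstance

/-! ### Inverse metrics and traces -/

section InverseFamily

variable {V : Type*} [AddCommGroup V] [Module ℝ V] {ι κ : Type*} [Fintype ι] [Fintype κ]

/-- The tensor `∑ᵢ xᵢ ⊗ yᵢ` is the inverse of the bilinear form `B`. -/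
def IsInverseFamily (B : V →ₗ[ℝ] V →ₗ[ℝ] ℝ) (x y : ι → V) : Prop :=
  ∀ w, ∑ i, B (x i) w • y i = w

variable {B : V →ₗ[ℝ] V →ₗ[ℝ] ℝ} {x y : ι → V} {x' y' : κ → V}

/-- The inverse of a symmetric form is a symmetric tensor. By nondegeneracy it suffices to pair both
sides with an arbitrary vector and expand that vector in the given family. -/
theorem IsInverseFamily.swap (h : IsInverseFamily B x y) (hs : ∀ v w, B v w = B w v)
    (hn : ∀ v, (∀ w, B v w = 0) → v = 0) : IsInverseFamily B y x := by
  intro w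
  rw [← sub_eq_zero]
  refine hn _ fun u => ?_
  have := congrArg (fun t => B w t) (h u)
  simp only [map_sum, map_smul, smul_eq_mul] at this
  simp only [map_sub, map_sum, map_smul, LinearMap.sub_apply, LinearMap.sum_apply,
    LinearMap.smul_apply, smul_eq_mul]
  rw [sub_eq_zero, ← this]
  refine Finset.sum_congr rfl fun i _ => ?_
  rw [hs (y i) w, mul_comm]

/-- Metric traces do not depend on the family used: expanding `y i` in the second family, or `x' j`
in the first, leads to the same double sum. This allows the coordinate frame to be exchanged for a
frame adapted to the submanifold. -/
theorem IsInverseFamily.sum_eq (h : IsInverseFamily B x y) (h' : IsInverseFamily B x' y')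
    (hs : ∀ v w, B v w = B w v) (hn : ∀ v, (∀ w, B v w = 0) → v = 0)
    (T : V →ₗ[ℝ] V →ₗ[ℝ] ℝ) : ∑ i, T (x i) (y i) = ∑ j, T (x' j) (y' j) := by
  have h1 : ∀ i, T (x i) (y i) = ∑ j, B (x' j) (y i) * T (x i) (y' j) := fun i => by
    conv_lhs => rw [← h' (y i)]
    simp
  have h2 : ∀ j, T (x' j) (y' j) = ∑ i, B (x' j) (y i) * T (x i) (y' j) := fun j => by
    conv_lhs => rw [← h.swap hs hn (x' j)]
    simp [hs (x' j)]
  simp_rw [h1, h2]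
  exact Finset.sum_comm

/-- The trace of a skew form composed with a self-adjoint endomorphism vanishes. -/
theorem IsInverseFamily.sum_skew (h : IsInverseFamily B x y)
    (hs : ∀ v w, B v w = B w v) (hn : ∀ v, (∀ w, B v w = 0) → v = 0)
    (T : V →ₗ[ℝ] V →ₗ[ℝ] ℝ) (hT : ∀ v w, T v w = -T w v)
    (K : V →ₗ[ℝ] V) (hK : ∀ v w, B (K v) w = B (K w) v) : ∑ i, T (K (x i)) (y i) = 0 := by
  have h0 : ∑ i, T (K (x i)) (y i) = ∑ i, T (K (y i)) (x i) :=
    h.sum_eq (h.swap hs hn) hs hn (T ∘ₗ K)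
  have h1 : ∀ i, T (K (y i)) (x i) = ∑ j, B (K (x j)) (y i) * T (y j) (x i) := fun i => by
    conv_lhs => rw [← h (K (y i))]
    simp only [map_sum, map_smul, LinearMap.sum_apply, LinearMap.smul_apply, smul_eq_mul]
    refine Finset.sum_congr rfl fun j _ => ?_
    rw [hs (x j), hK]
  have h2 : ∀ j, T (y j) (K (x j)) = ∑ i, B (K (x j)) (y i) * T (y j) (x i) := fun j => by
    conv_lhs => rw [← h.swap hs hn (K (x j))]
    simp only [map_sum, map_smul, smul_eq_mul]
    refine Finset.sum_congr rfl fun i _ => ?_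
    rw [hs (y i)]
  -- Self-adjointness moves `K` to the other argument and skewness brings it back with a sign;
  -- together with `h0` the trace equals its own negative.
  have h3 : ∑ i, T (K (y i)) (x i) = -∑ i, T (K (x i)) (y i) := by
    rw [← Finset.sum_neg_distrib]
    simp_rw [← hT, h1, h2]
    exact Finset.sum_comm
  linarith

end InverseFamily

/-! ### Alternating forms evaluated on explicit vectors -/

section Forms

variable {V : Type*} [NormedAddCommGroup V] [NormedSpace ℝ V] (A : V [⋀^Fin 4]→L[ℝ] ℝ)

theorem update_four_zero {V : Type*} (a b c d t : V) :
    Function.update ![a, b, c, d] 0 t = ![t, b, c, d] := by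
  ext i; fin_cases i <;> rfl

theorem update_four_one {V : Type*} (a b c d t : V) :
    Function.update ![a, b, c, d] 1 t = ![a, t, c, d] := by
  ext i; fin_cases i <;> rfl

theorem update_four_two {V : Type*} (a b c d t : V) :
    Function.update ![a, b, c, d] 2 t = ![a, b, t, d] := by
  ext i; fin_cases i <;> rfl

theorem update_four_three {V : Type*} (a b c d t : V) :
    Function.update ![a, b, c, d] 3 t = ![a, b, c, t] := by
  ext i; fin_cases i <;> rfl

theorem form_add_zero (a a' b c d : V) :
    A ![a + a', b, c, d] = A ![a, b, c, d] + A ![a', b, c, d] := by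
  simpa [update_four_zero] using A.map_update_add ![0, b, c, d] 0 a a'

theorem form_add_one (a b b' c d : V) :
    A ![a, b + b', c, d] = A ![a, b, c, d] + A ![a, b', c, d] := by
  simpa [update_four_one] using A.map_update_add ![a, 0, c, d] 1 b b'

theorem form_add_two (a b c c' d : V) :
    A ![a, b, c + c', d] = A ![a, b, c, d] + A ![a, b, c', d] := by
  simpa [update_four_two] using A.map_update_add ![a, b, 0, d] 2 c c'

theorem form_add_three (a b c d d' : V) :
    A ![a, b, c, d + d'] = A ![a, b, c, d] + A ![a, b, c, d'] := by
  simpa [update_four_three] using A.map_update_add ![a, b, c, 0] 3 d d'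

theorem form_smul_zero (r : ℝ) (a b c d : V) : A ![r • a, b, c, d] = r * A ![a, b, c, d] := by
  simpa [update_four_zero] using A.map_update_smul ![0, b, c, d] 0 r a

theorem form_smul_one (r : ℝ) (a b c d : V) : A ![a, r • b, c, d] = r * A ![a, b, c, d] := by
  simpa [update_four_one] using A.map_update_smul ![a, 0, c, d] 1 r b

theorem form_smul_two (r : ℝ) (a b c d : V) : A ![a, b, r • c, d] = r * A ![a, b, c, d] := by
  simpa [update_four_two] using A.map_update_smul ![a, b, 0, d] 2 r c

theorem form_smul_three (r : ℝ) (a b c d : V) : A ![a, b, c, r • d] = r * A ![a, b, c, d] := by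
  simpa [update_four_three] using A.map_update_smul ![a, b, c, 0] 3 r d

theorem form_swap_zero_one (a b c d : V) : A ![b, a, c, d] = -A ![a, b, c, d] := by
  refine (congrArg A ?_).trans
    (A.toAlternatingMap.map_swap ![a, b, c, d] (i := 0) (j := 1) (by decide))
  ext i; fin_cases i <;> rfl

theorem form_swap_one_two (a b c d : V) : A ![a, c, b, d] = -A ![a, b, c, d] := by
  refine (congrArg A ?_).trans
    (A.toAlternatingMap.map_swap ![a, b, c, d] (i := 1) (j := 2) (by decide))
  ext i; fin_cases i <;> rfl

theorem form_swap_zero_two (a b c d : V) : A ![c, b, a, d] = -A ![a, b, c, d] := by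
  refine (congrArg A ?_).trans
    (A.toAlternatingMap.map_swap ![a, b, c, d] (i := 0) (j := 2) (by decide))
  ext i; fin_cases i <;> rfl

theorem form_cycle (a b c d : V) : A ![c, a, b, d] = A ![a, b, c, d] := by
  rw [form_swap_zero_one, form_swap_one_two, neg_neg]

theorem form_eq_zero_zero_one (a c d : V) : A ![a, a, c, d] = 0 :=
  A.map_eq_zero_of_eq _ (i := 0) (j := 1) rfl (by decide)

theorem form_eq_zero_zero_two (a b d : V) : A ![a, b, a, d] = 0 :=
  A.map_eq_zero_of_eq _ (i := 0) (j := 2) rfl (by decide)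

theorem form_eq_zero_zero_three (a b c : V) : A ![a, b, c, a] = 0 :=
  A.map_eq_zero_of_eq _ (i := 0) (j := 3) rfl (by decide)

theorem form_eq_zero_one_two (a b d : V) : A ![a, b, b, d] = 0 :=
  A.map_eq_zero_of_eq _ (i := 1) (j := 2) rfl (by decide)

theorem form_eq_zero_one_three (a b c : V) : A ![a, b, c, b] = 0 :=
  A.map_eq_zero_of_eq _ (i := 1) (j := 3) rfl (by decide)

end Forms

/-! ### The Levi-Civita connection in coordinates -/

section Christoffel

variable {n : ℕ} {G : Coord n → Coord n →L[ℝ] Coord n →L[ℝ] ℝ} {y : Coord n}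

theorem isInvertible_of_nondegenerate {B : Coord n →L[ℝ] Coord n →L[ℝ] ℝ}
    (hn : ∀ v, (∀ w, B v w = 0) → v = 0) : B.IsInvertible := by
  have hinj : Function.Injective B.toLinearMap := by
    rw [← LinearMap.ker_eq_bot, LinearMap.ker_eq_bot']
    exact fun v hv => hn v fun w => by simpa using DFunLike.congr_fun hv w
  have hfin : finrank ℝ (Coord n) = finrank ℝ (Coord n →L[ℝ] ℝ) := by
    rw [← LinearEquiv.finrank_eq
      (LinearMap.toContinuousLinearMap : (Coord n →ₗ[ℝ] ℝ) ≃ₗ[ℝ] (Coord n →L[ℝ] ℝ))]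
    exact (Subspace.dual_finrank_eq (K := ℝ) (V := Coord n)).symm
  refine ⟨(B.toLinearMap.linearEquivOfInjective hinj hfin).toContinuousLinearEquiv, ?_⟩
  ext v w
  rfl

theorem apply_sharp (hn : ∀ v, (∀ w, G y v w = 0) → v = 0) (φ : Coord n →L[ℝ] ℝ) :
    G y (sharp G y φ) = φ := by
  obtain ⟨e, he⟩ := isInvertible_of_nondegenerate hn
  rw [sharp, ← he, ContinuousLinearMap.inverse_equiv]
  simp

theorem sharp_apply (hn : ∀ v, (∀ w, G y v w = 0) → v = 0) (v : Coord n) :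
    sharp G y (G y v) = v := by
  obtain ⟨e, he⟩ := isInvertible_of_nondegenerate hn
  rw [sharp, ← he, ContinuousLinearMap.inverse_equiv]
  simp

/-- Identifies the coordinate sum in `codifferential` as a metric trace: `∑ G(eᵢ, w) eⁱ` is the
covector `G w`, and raising its index returns `w`. -/
theorem isInverseFamily_sharp (hs : ∀ v w, G y v w = G y w v)
    (hn : ∀ v, (∀ w, G y v w = 0) → v = 0) :
    IsInverseFamily (G y).toBilinForm (fun i : Fin n => EuclideanSpace.single i (1 : ℝ))
      fun i => sharp G y (EuclideanSpace.proj i) := by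
  intro w
  simp only [ContinuousLinearMap.toBilinForm_apply, ← map_smul, ← map_sum]
  conv_rhs => rw [← sharp_apply hn w]
  congr 1
  ext v
  conv_rhs => rw [hs w, ← (EuclideanSpace.basisFun (Fin n) ℝ).sum_repr v]
  simp only [map_sum, map_smul]
  simp [mul_comm]

/-- Koszul's formula. -/
theorem apply_christoffel (hn : ∀ v, (∀ w, G y v w = 0) → v = 0) (u v w : Coord n) :
    G y (christoffel G y u v) w =
      1 / 2 * (fderiv ℝ G y u v w + fderiv ℝ G y v u w - fderiv ℝ G y w u v) := by
  rw [christoffel, apply_sharp hn]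
  simp

theorem christoffel_add_left (u u' v : Coord n) :
    christoffel G y (u + u') v = christoffel G y u v + christoffel G y u' v := by
  rw [christoffel, christoffel, christoffel, ← (sharp G y).map_add]
  refine congrArg (sharp G y) ?_
  ext w
  simp only [ContinuousLinearMap.map_add, add_apply, sub_apply,
    smul_apply, ContinuousLinearMap.flip_apply, smul_eq_mul]
  ring

theorem christoffel_smul_left (r : ℝ) (u v : Coord n) :
    christoffel G y (r • u) v = r • christoffel G y u v := by
  rw [christoffel, christoffel, ← (sharp G y).map_smul]
  refine congrArg (sharp G y) ?_
  ext w
  simp only [ContinuousLinearMap.map_smul, add_apply, sub_apply,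
    smul_apply, ContinuousLinearMap.flip_apply, smul_eq_mul]
  ring

theorem christoffel_add_right (u v v' : Coord n) :
    christoffel G y u (v + v') = christoffel G y u v + christoffel G y u v' := by
  rw [christoffel, christoffel, christoffel, ← (sharp G y).map_add]
  refine congrArg (sharp G y) ?_
  ext w
  simp only [ContinuousLinearMap.map_add, add_apply, sub_apply,
    smul_apply, ContinuousLinearMap.flip_apply, smul_eq_mul]
  ring

theorem christoffel_smul_right (r : ℝ) (u v : Coord n) :
    christoffel G y u (r • v) = r • christoffel G y u v := by
  rw [christoffel, christoffel, ← (sharp G y).map_smul]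
  refine congrArg (sharp G y) ?_
  ext w
  simp only [ContinuousLinearMap.map_smul, add_apply, sub_apply,
    smul_apply, ContinuousLinearMap.flip_apply, smul_eq_mul]
  ring

theorem fderiv_symm (hs : ∀ z v w, G z v w = G z w v) (hG : DifferentiableAt ℝ G y)
    (u v w : Coord n) : fderiv ℝ G y u v w = fderiv ℝ G y u w v := by
  have h : ∀ v w, fderiv ℝ (fun z => G z v w) y u = fderiv ℝ G y u v w := fun v w => by
    have h1 : DifferentiableAt ℝ (fun z => G z v) y := hG.clm_apply (differentiableAt_const v)
    rw [fderiv_clm_apply h1 (differentiableAt_const w),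
      fderiv_clm_apply hG (differentiableAt_const v)]
    simp
  rw [← h, ← h]
  simp_rw [hs _ v w]

/-- The Levi-Civita connection is torsion-free. -/
theorem christoffel_symm (hs : ∀ z v w, G z v w = G z w v) (hG : DifferentiableAt ℝ G y)
    (u v : Coord n) : christoffel G y u v = christoffel G y v u := by
  simp only [christoffel]
  congr 2
  ext w
  simp [fderiv_symm hs hG w u v]
  ring

/-- The Levi-Civita connection is metric. -/
theorem fderiv_apply_eq_christoffel (hs : ∀ z v w, G z v w = G z w v)
    (hG : DifferentiableAt ℝ G y) (hn : ∀ v, (∀ w, G y v w = 0) → v = 0) (u v w : Coord n) :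
    fderiv ℝ G y u v w = G y (christoffel G y u v) w + G y v (christoffel G y u w) := by
  rw [hs y v, apply_christoffel hn, apply_christoffel hn, fderiv_symm hs hG u w v,
    fderiv_symm hs hG v u w, fderiv_symm hs hG w u v]
  ring

theorem christoffel_congr {G' : Coord n → Coord n →L[ℝ] Coord n →L[ℝ] ℝ} (h : G =ᶠ[nhds y] G') :
    christoffel G y = christoffel G' y := by
  funext u v
  simp only [christoffel, sharp, h.fderiv_eq, h.eq_of_nhds]

end Christoffel

/-! ### Differentiability from components -/

section Components

variable {E H : Type*} [NormedAddCommGroup E] [NormedSpace ℝ E] [NormedAddCommGroup H]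
  [NormedSpace ℝ H] {n : ℕ} {x : E}

theorem differentiableAt_of_apply {f : E → Coord n →L[ℝ] H}
    (h : ∀ v, DifferentiableAt ℝ (fun x => f x v) x) : DifferentiableAt ℝ f x := by
  have hf : f = fun x => ∑ i : Fin n,
      ContinuousLinearMap.smulRightL ℝ (Coord n) H (EuclideanSpace.proj i)
        (f x (EuclideanSpace.single i 1)) := by
    funext x
    ext v
    conv_lhs => rw [← (EuclideanSpace.basisFun (Fin n) ℝ).sum_repr v]
    simp [ContinuousLinearMap.smulRightL]
  rw [hf]
  refine DifferentiableAt.fun_sum fun i _ => ?_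
  exact (ContinuousLinearMap.differentiableAt _).comp x (h _)

theorem differentiableAt_form_of_apply {k : ℕ} {f : E → Coord n [⋀^Fin k]→L[ℝ] ℝ}
    (h : ∀ v : Fin k → Coord n, DifferentiableAt ℝ (fun x => f x v) x) :
    DifferentiableAt ℝ f x := by
  let b := (EuclideanSpace.basisFun (Fin n) ℝ).toBasis
  let φ : (Coord n [⋀^Fin k]→L[ℝ] ℝ) →ₗ[ℝ] ((Fin k → Fin n) → ℝ) :=
    { toFun := fun A r => A fun i => b (r i)
      map_add' := fun _ _ => rfl
      map_smul' := fun _ _ => rfl }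
  -- A multilinear map is determined by its values on tuples of basis vectors. A linear left inverse
  -- of `φ` then recovers `f` from finitely many differentiable components.
  have hφ : Function.Injective φ := by
    intro A B hAB
    have : A.toMultilinearMap = B.toMultilinearMap :=
      Basis.ext_multilinear (fun _ => b) fun r => congrFun hAB r
    ext v
    exact congrArg (fun C => C v) this
  obtain ⟨ψ, hψ⟩ := φ.exists_leftInverse_of_injective (LinearMap.ker_eq_bot.2 hφ)
  have hf : f = fun x => LinearMap.toContinuousLinearMap ψ (φ (f x)) := by
    funext x
    exact (DFunLike.congr_fun hψ (f x)).symm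
  rw [hf]
  refine (ContinuousLinearMap.differentiableAt _).comp x ?_
  exact differentiableAt_pi.2 fun r => h fun i => b (r i)

theorem fderiv_apply_const {f : E → Coord n →L[ℝ] H} (hf : DifferentiableAt ℝ f x) (u : E)
    (v : Coord n) : fderiv ℝ (fun x => f x v) x u = fderiv ℝ f x u v := by
  rw [fderiv_clm_apply hf (differentiableAt_const v)]
  simp

end Components

/-! ### Immersions in coordinates -/

section Immersion

variable {n m : ℕ} {G : Coord m → Coord m →L[ℝ] Coord m →L[ℝ] ℝ} {F : Coord n → Coord m}
  {y : Coord n}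

/-- The pullback of the metric `G` by `F`. -/
def pullbackForm (G : Coord m → Coord m →L[ℝ] Coord m →L[ℝ] ℝ) (F : Coord n → Coord m)
    (y : Coord n) : Coord n →L[ℝ] Coord n →L[ℝ] ℝ :=
  ((fderiv ℝ F y).precomp ℝ).comp ((G (F y)).comp (fderiv ℝ F y))

theorem pullbackForm_apply (u v : Coord n) :
    pullbackForm G F y u v = G (F y) (fderiv ℝ F y u) (fderiv ℝ F y v) := rfl

/-- The covariant derivative along `F` of the vector field `s`. -/
def covAlong (G : Coord m → Coord m →L[ℝ] Coord m →L[ℝ] ℝ) (F : Coord n → Coord m) (y : Coord n)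
    (s : Coord n → Coord m) (u : Coord n) : Coord m :=
  fderiv ℝ s y u + christoffel G (F y) (fderiv ℝ F y u) (s y)

theorem covAlong_add (s : Coord n → Coord m) (u u' : Coord n) :
    covAlong G F y s (u + u') = covAlong G F y s u + covAlong G F y s u' := by
  simp only [covAlong, ContinuousLinearMap.map_add, christoffel_add_left]
  abel

theorem covAlong_smul (s : Coord n → Coord m) (r : ℝ) (u : Coord n) :
    covAlong G F y s (r • u) = r • covAlong G F y s u := by
  simp only [covAlong, ContinuousLinearMap.map_smul, christoffel_smul_left, smul_add]

/-- Metric compatibility for fields along a map: the derivative of `G` contributes exactly the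
Christoffel terms that complete the derivatives of `s` and `t` to covariant ones. -/
theorem fderiv_metric_along (hs : ∀ z v w, G z v w = G z w v)
    (hn : ∀ v, (∀ w, G (F y) v w = 0) → v = 0) (hG : DifferentiableAt ℝ G (F y))
    (hF : DifferentiableAt ℝ F y) {s t : Coord n → Coord m} (hds : DifferentiableAt ℝ s y)
    (hdt : DifferentiableAt ℝ t y) (u : Coord n) :
    fderiv ℝ (fun x => G (F x) (s x) (t x)) y u =
      G (F y) (covAlong G F y s u) (t y) + G (F y) (s y) (covAlong G F y t u) := by
  have hGF : DifferentiableAt ℝ (fun x => G (F x)) y := hG.fun_comp' y hF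
  have h1 : fderiv ℝ (fun x => G (F x)) y u = fderiv ℝ G (F y) (fderiv ℝ F y u) := by
    have := fderiv_fun_comp y hG hF
    rw [this]
    rfl
  rw [fderiv_clm_apply (hGF.clm_apply hds) hdt, fderiv_clm_apply hGF hds]
  simp only [add_apply, ContinuousLinearMap.comp_apply, ContinuousLinearMap.flip_apply, h1,
    fderiv_apply_eq_christoffel hs hG hn, covAlong, ContinuousLinearMap.map_add]
  ring

theorem differentiableAt_fderiv (hF : ContDiffAt ℝ 2 F y) : DifferentiableAt ℝ (fderiv ℝ F) y :=
  (hF.fderiv_right (m := 1) (by norm_num)).differentiableAt (by norm_num)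

theorem differentiableAt_fderiv_apply (hF : ContDiffAt ℝ 2 F y) (v : Coord n) :
    DifferentiableAt ℝ (fun x => fderiv ℝ F x v) y :=
  (differentiableAt_fderiv hF).clm_apply (differentiableAt_const v)

/-- Symmetry of second derivatives combined with the absence of torsion. It is the source of both
Gauss' formula and the self-adjointness of the shape operators. -/
theorem covAlong_fderiv_symm (hs : ∀ z v w, G z v w = G z w v)
    (hG : DifferentiableAt ℝ G (F y)) (hF : ContDiffAt ℝ 2 F y) (u v : Coord n) :
    covAlong G F y (fun x => fderiv ℝ F x v) u = covAlong G F y (fun x => fderiv ℝ F x u) v := by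
  have h := (hF.isSymmSndFDerivAt (by simp)).eq u v
  rw [covAlong, covAlong, fderiv_apply_const (differentiableAt_fderiv hF),
    fderiv_apply_const (differentiableAt_fderiv hF), h, christoffel_symm hs hG]

theorem differentiableAt_pullbackForm (hG : DifferentiableAt ℝ G (F y))
    (hF : ContDiffAt ℝ 2 F y) : DifferentiableAt ℝ (pullbackForm G F) y := by
  refine differentiableAt_of_apply fun u => differentiableAt_of_apply fun v => ?_
  have hF' : DifferentiableAt ℝ F y := hF.differentiableAt (by norm_num)
  exact ((hG.fun_comp' y hF').clm_apply (differentiableAt_fderiv_apply hF u)).clm_apply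
    (differentiableAt_fderiv_apply hF v)

/-- Gauss' formula: the tangential part of the ambient connection is the induced connection. -/
theorem apply_covAlong_fderiv (hs : ∀ z v w, G z v w = G z w v)
    (hn : ∀ v, (∀ w, G (F y) v w = 0) → v = 0) (hG : DifferentiableAt ℝ G (F y))
    (hF : ContDiffAt ℝ 2 F y) (hn' : ∀ v, (∀ w, pullbackForm G F y v w = 0) → v = 0)
    (u v w : Coord n) :
    G (F y) (covAlong G F y (fun x => fderiv ℝ F x v) u) (fderiv ℝ F y w) =
      G (F y) (fderiv ℝ F y (christoffel (pullbackForm G F) y u v)) (fderiv ℝ F y w) := by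
  have hF' : DifferentiableAt ℝ F y := hF.differentiableAt (by norm_num)
  have hg := differentiableAt_pullbackForm hG hF
  -- The first derivatives of the induced metric are ambient covariant derivatives. Inserted in
  -- Koszul's formula for the induced connection, they cancel by the symmetry of `∇dF` except for
  -- two equal terms.
  have key : ∀ u v w, fderiv ℝ (pullbackForm G F) y u v w =
      G (F y) (covAlong G F y (fun x => fderiv ℝ F x v) u) (fderiv ℝ F y w) +
      G (F y) (fderiv ℝ F y v) (covAlong G F y (fun x => fderiv ℝ F x w) u) := by
    intro u v w
    rw [← fderiv_metric_along hs hn hG hF' (differentiableAt_fderiv_apply hF v)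
      (differentiableAt_fderiv_apply hF w), ← fderiv_apply_const hg, ← fderiv_apply_const
      (hg.clm_apply (differentiableAt_const v))]
    rfl
  have h := apply_christoffel hn' u v w
  rw [pullbackForm_apply] at h
  rw [h, key, key, key, covAlong_fderiv_symm hs hG hF v u, covAlong_fderiv_symm hs hG hF w u,
    covAlong_fderiv_symm hs hG hF w v, hs (F y) (fderiv ℝ F y u),
    hs (F y) (fderiv ℝ F y v)]
  ring

end Immersion

/-! ### The covariant derivative of the form `-μ(a, b, ·, ·)` -/

section CovDeriv

variable {n : ℕ} {G : Coord n → Coord n →L[ℝ] Coord n →L[ℝ] ℝ} {y : Coord n}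

theorem covDeriv_four (A : Coord n → Coord n [⋀^Fin 4]→L[ℝ] ℝ) (u p q r s : Coord n) :
    covDeriv G A y u ![p, q, r, s] = fderiv ℝ A y u ![p, q, r, s] -
      (A y ![christoffel G y u p, q, r, s] + A y ![p, christoffel G y u q, r, s] +
        A y ![p, q, christoffel G y u r, s] + A y ![p, q, r, christoffel G y u s]) := by
  rw [covDeriv, Fin.sum_univ_four, update_four_zero, update_four_one, update_four_two,
    update_four_three]
  rfl

theorem covDeriv_two (A : Coord n → Coord n [⋀^Fin 2]→L[ℝ] ℝ) (u p q : Coord n) :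
    covDeriv G A y u ![p, q] = fderiv ℝ A y u ![p, q] -
      (A y ![christoffel G y u p, q] + A y ![p, christoffel G y u q]) := by
  have h0 : ∀ t, Function.update ![p, q] 0 t = ![t, q] := fun t => by
    ext i; fin_cases i <;> rfl
  have h1 : ∀ t, Function.update ![p, q] 1 t = ![p, t] := fun t => by
    ext i; fin_cases i <;> rfl
  rw [covDeriv, Fin.sum_univ_two, h0, h1]
  rfl

/-- The codifferential contracts the first slot, whereas the form `μ(a, b, ·, ·)` is contracted in
the third slot of `μ`; a cyclic permutation of three slots is even and costs no sign. -/
theorem covDeriv_cycle (A : Coord n → Coord n [⋀^Fin 4]→L[ℝ] ℝ) (u a b c d : Coord n) :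
    covDeriv G A y u ![c, a, b, d] = covDeriv G A y u ![a, b, c, d] := by
  simp only [covDeriv_four, form_cycle _ a b c d, form_cycle _ a b (christoffel G y u c) d,
    form_cycle _ (christoffel G y u a) b c d, form_cycle _ a (christoffel G y u b) c d,
    form_cycle _ a b c (christoffel G y u d)]
  ring

/-- The covariant derivative of an alternating form is alternating: the Christoffel terms in the two
equal slots cancel each other, and the remaining terms have a repeated argument. -/
theorem covDeriv_eq_zero_left (A : Coord n → Coord n [⋀^Fin 4]→L[ℝ] ℝ) (u a b d : Coord n) :
    covDeriv G A y u ![a, b, a, d] = 0 := by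
  simp only [covDeriv_four, form_eq_zero_zero_two,
    form_swap_zero_two (A y) a b (christoffel G y u a) d]
  ring

theorem covDeriv_eq_zero_right (A : Coord n → Coord n [⋀^Fin 4]→L[ℝ] ℝ) (u a b d : Coord n) :
    covDeriv G A y u ![a, b, b, d] = 0 := by
  simp only [covDeriv_four, form_eq_zero_one_two,
    form_swap_one_two (A y) a b (christoffel G y u b) d]
  ring

/-- The covariant derivative of a `4`-form as a bilinear map of the direction and the third
argument. -/
def covDerivBilin (G : Coord n → Coord n →L[ℝ] Coord n →L[ℝ] ℝ)
    (A : Coord n → Coord n [⋀^Fin 4]→L[ℝ] ℝ) (y a b d : Coord n) :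
    Coord n →ₗ[ℝ] Coord n →ₗ[ℝ] ℝ :=
  LinearMap.mk₂ ℝ (fun u v => covDeriv G A y u ![a, b, v, d])
    (fun u u' v => by
      simp only [covDeriv_four, ContinuousLinearMap.map_add, christoffel_add_left, form_add_zero,
        form_add_one, form_add_two, form_add_three, ContinuousAlternatingMap.add_apply]
      ring)
    (fun r u v => by
      simp only [covDeriv_four, ContinuousLinearMap.map_smul, christoffel_smul_left,
        form_smul_zero, form_smul_one, form_smul_two, form_smul_three,
        ContinuousAlternatingMap.smul_apply, smul_eq_mul]
      ring)
    (fun u v v' => by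
      simp only [covDeriv_four, christoffel_add_right, form_add_two]
      ring)
    (fun r u v => by
      simp only [covDeriv_four, christoffel_smul_right, form_smul_two, smul_eq_mul]
      ring)

theorem covDerivBilin_apply (A : Coord n → Coord n [⋀^Fin 4]→L[ℝ] ℝ) (a b d u v : Coord n) :
    covDerivBilin G A y a b d u v = covDeriv G A y u ![a, b, v, d] := rfl

theorem covDeriv_congr {G' : Coord n → Coord n →L[ℝ] Coord n →L[ℝ] ℝ} (h : G =ᶠ[nhds y] G')
    {k : ℕ} (A : Coord n → Coord n [⋀^Fin k]→L[ℝ] ℝ) : covDeriv G A y = covDeriv G' A y := by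
  funext u w
  simp only [covDeriv, christoffel_congr h]

end CovDeriv

/-! ### Normal frames, shape operators and the trace of the covariant derivative -/

section NormalFrame

variable {n m : ℕ} {G : Coord m → Coord m →L[ℝ] Coord m →L[ℝ] ℝ} {F : Coord n → Coord m}
  {y : Coord n} {a b : Coord n → Coord m}

/-- `α`, `β` is an orthonormal basis of the orthogonal complement of the range of `D`. -/
structure IsOrthonormalComplement (B : Coord m →L[ℝ] Coord m →L[ℝ] ℝ)
    (D : Coord n →L[ℝ] Coord m) (α β : Coord m) : Prop where
  left_self : B α α = 1 ∨ B α α = -1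
  right_self : B β β = 1 ∨ B β β = -1
  inner_eq_zero : B α β = 0
  normal_left : ∀ v, B α (D v) = 0
  normal_right : ∀ v, B β (D v) = 0
  span : ∀ w, B w α = 0 → B w β = 0 → (∀ v, B w (D v) = 0) → w = 0

namespace IsOrthonormalComplement

variable {B : Coord m →L[ℝ] Coord m →L[ℝ] ℝ} {D : Coord n →L[ℝ] Coord m} {α β : Coord m}

theorem swap (h : IsOrthonormalComplement B D α β) (hs : ∀ v w, B v w = B w v) :
    IsOrthonormalComplement B D β α where
  left_self := h.right_self
  right_self := h.left_self
  inner_eq_zero := by rw [hs, h.inner_eq_zero]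
  normal_left := h.normal_right
  normal_right := h.normal_left
  span := fun w h1 h2 => h.span w h2 h1

theorem left_sq (h : IsOrthonormalComplement B D α β) : B α α * B α α = 1 := by
  rcases h.left_self with h | h <;> simp [h]

theorem right_sq (h : IsOrthonormalComplement B D α β) : B β β * B β β = 1 := by
  rcases h.right_self with h | h <;> simp [h]

/-- A vector orthogonal to the range of `D` is a combination of `α` and `β`. -/
theorem eq_of_normal (h : IsOrthonormalComplement B D α β) (hs : ∀ v w, B v w = B w v)
    (w : Coord m) (hw : ∀ v, B w (D v) = 0) :
    w = (B α α * B w α) • α + (B β β * B w β) • β := by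
  have ha := h.left_sq
  have hb := h.right_sq
  have hab := h.inner_eq_zero
  have hba := (h.swap hs).inner_eq_zero
  rw [← sub_eq_zero]
  refine h.span _ ?_ ?_ fun v => ?_
  · simp only [map_sub, map_add, map_smul, sub_apply, add_apply, smul_apply, smul_eq_mul, hba]
    linear_combination (-B w α) * ha
  · simp only [map_sub, map_add, map_smul, sub_apply, add_apply, smul_apply, smul_eq_mul, hab]
    linear_combination (-B w β) * hb
  · simp [hw, h.normal_left, h.normal_right]

/-- The form induced on the domain of `D` is nondegenerate. -/
theorem nondegenerate (h : IsOrthonormalComplement B D α β) (hs : ∀ v w, B v w = B w v)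
    (hD : Function.Injective D) (v : Coord n) (hv : ∀ w, B (D v) (D w) = 0) : v = 0 :=
  hD ((h.span _ ((hs _ _).trans (h.normal_left v)) ((hs _ _).trans (h.normal_right v)) hv).trans
    D.map_zero.symm)

end IsOrthonormalComplement

/-- A metric `G`, an immersion `F` of codimension two, and normal fields `a`, `b` along `F` with
constant Gram determinant, orthonormal at `y`. -/
structure IsNormalFrameAt (G : Coord m → Coord m →L[ℝ] Coord m →L[ℝ] ℝ) (F : Coord n → Coord m)
    (y : Coord n) (a b : Coord n → Coord m) : Prop where
  symm : ∀ z v w, G z v w = G z w v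
  nondegenerate : ∀ v, (∀ w, G (F y) v w = 0) → v = 0
  differentiableAt_metric : DifferentiableAt ℝ G (F y)
  contDiffAt : ContDiffAt ℝ 2 F y
  injective : Function.Injective (fderiv ℝ F y)
  differentiableAt_left : DifferentiableAt ℝ a y
  differentiableAt_right : DifferentiableAt ℝ b y
  normal_left : ∀ᶠ x in nhds y, ∀ v, G (F x) (a x) (fderiv ℝ F x v) = 0
  normal_right : ∀ᶠ x in nhds y, ∀ v, G (F x) (b x) (fderiv ℝ F x v) = 0
  gram : ∃ c : ℝ, ∀ᶠ x in nhds y,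
    G (F x) (a x) (a x) * G (F x) (b x) (b x) - G (F x) (a x) (b x) ^ 2 = c
  frame : IsOrthonormalComplement (G (F y)) (fderiv ℝ F y) (a y) (b y)

namespace IsNormalFrameAt

variable (h : IsNormalFrameAt G F y a b)
include h

theorem swap : IsNormalFrameAt G F y b a where
  symm := h.symm
  nondegenerate := h.nondegenerate
  differentiableAt_metric := h.differentiableAt_metric
  contDiffAt := h.contDiffAt
  injective := h.injective
  differentiableAt_left := h.differentiableAt_right
  differentiableAt_right := h.differentiableAt_left
  normal_left := h.normal_right
  normal_right := h.normal_left
  gram := by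
    obtain ⟨c, hc⟩ := h.gram
    refine ⟨c, hc.mono fun x hx => ?_⟩
    rw [h.symm _ (b x) (a x), mul_comm, hx]
  frame := h.frame.swap (h.symm _)

theorem differentiableAt : DifferentiableAt ℝ F y := h.contDiffAt.differentiableAt (by norm_num)

theorem pullback_symm (v w : Coord n) : pullbackForm G F y v w = pullbackForm G F y w v := by
  rw [pullbackForm_apply, pullbackForm_apply, h.symm]

theorem pullback_nondegenerate (v : Coord n) (hv : ∀ w, pullbackForm G F y v w = 0) : v = 0 :=
  h.frame.nondegenerate (h.symm _) h.injective v hv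

/-- The tangential part of a vector at `F y`. -/
theorem apply_fderiv_sharp (w : Coord m) (v : Coord n) :
    G (F y) (fderiv ℝ F y (sharp (pullbackForm G F) y ((G (F y) w).comp (fderiv ℝ F y))))
      (fderiv ℝ F y v) = G (F y) w (fderiv ℝ F y v) := by
  rw [← pullbackForm_apply, apply_sharp h.pullback_nondegenerate]
  rfl

omit h in
/-- The (negative of the) shape operator of the normal field `a`. -/
def shape (G : Coord m → Coord m →L[ℝ] Coord m →L[ℝ] ℝ) (F : Coord n → Coord m)
    (y : Coord n) (a : Coord n → Coord m) : Coord n →ₗ[ℝ] Coord n where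
  toFun u := sharp (pullbackForm G F) y ((G (F y) (covAlong G F y a u)).comp (fderiv ℝ F y))
  map_add' u u' := by
    rw [covAlong_add, ← ContinuousLinearMap.map_add]
    refine congrArg _ ?_
    ext v
    simp
  map_smul' r u := by
    rw [covAlong_smul, RingHom.id_apply, ← ContinuousLinearMap.map_smul]
    refine congrArg _ ?_
    ext v
    simp

theorem apply_shape (u v : Coord n) :
    G (F y) (fderiv ℝ F y (shape G F y a u)) (fderiv ℝ F y v) =
      G (F y) (covAlong G F y a u) (fderiv ℝ F y v) :=
  h.apply_fderiv_sharp _ _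

theorem fderiv_metric_along {s t : Coord n → Coord m} (hs : DifferentiableAt ℝ s y)
    (ht : DifferentiableAt ℝ t y) (u : Coord n) :
    fderiv ℝ (fun x => G (F x) (s x) (t x)) y u =
      G (F y) (covAlong G F y s u) (t y) + G (F y) (s y) (covAlong G F y t u) :=
  ParaGray.fderiv_metric_along h.symm h.nondegenerate h.differentiableAt_metric
    h.differentiableAt hs ht u

/-- Weingarten's formula. -/
theorem weingarten (u v : Coord n) : G (F y) (covAlong G F y a u) (fderiv ℝ F y v) =
    -G (F y) (a y) (covAlong G F y (fun x => fderiv ℝ F x v) u) := by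
  have h1 := h.fderiv_metric_along h.differentiableAt_left
    (differentiableAt_fderiv_apply h.contDiffAt v) u
  have h2 : (fun x => G (F x) (a x) (fderiv ℝ F x v)) =ᶠ[nhds y] fun _ => 0 :=
    h.normal_left.mono fun x hx => hx v
  rw [h2.fderiv_eq] at h1
  simp only [fderiv_fun_const, Pi.zero_apply, zero_apply] at h1
  linarith

/-- By Weingarten's formula both sides pair `a` with the second derivative of `F`, which is
symmetric in `u` and `v`. -/
theorem shape_symm (u v : Coord n) : pullbackForm G F y (shape G F y a u) v =
    pullbackForm G F y (shape G F y a v) u := by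
  rw [pullbackForm_apply, pullbackForm_apply, h.apply_shape, h.apply_shape, h.weingarten,
    h.weingarten, covAlong_fderiv_symm h.symm h.differentiableAt_metric h.contDiffAt]

/-- The normal connection of the frame has no trace, as the Gram determinant is constant. -/
theorem trace_normal_connection (u : Coord n) :
    G (F y) (a y) (a y) * G (F y) (covAlong G F y a u) (a y) +
      G (F y) (b y) (b y) * G (F y) (covAlong G F y b u) (b y) = 0 := by
  obtain ⟨c, hc⟩ := h.gram
  have hd : ∀ {s t : Coord n → Coord m}, DifferentiableAt ℝ s y → DifferentiableAt ℝ t y →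
      DifferentiableAt ℝ (fun x => G (F x) (s x) (t x)) y := fun hs ht =>
    ((h.differentiableAt_metric.fun_comp' y h.differentiableAt).clm_apply hs).clm_apply ht
  have ha := h.differentiableAt_left
  have hb := h.differentiableAt_right
  have h1 : fderiv ℝ (fun x => G (F x) (a x) (a x) * G (F x) (b x) (b x) -
      G (F x) (a x) (b x) ^ 2) y u = 0 := by
    rw [Filter.EventuallyEq.fderiv_eq (f := fun _ => c) hc]
    simp
  rw [fderiv_fun_sub ((hd ha ha).fun_mul (hd hb hb)) ((hd ha hb).fun_pow 2),
    fderiv_fun_mul (hd ha ha) (hd hb hb), fderiv_fun_pow 2 (hd ha hb)] at h1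
  simp only [sub_apply, add_apply, smul_apply, h.fderiv_metric_along ha ha,
    h.fderiv_metric_along hb hb, h.frame.inner_eq_zero, h.symm _ (a y) (covAlong _ _ _ _ _),
    h.symm _ (b y) (covAlong _ _ _ _ _), smul_eq_mul] at h1
  -- As `⟨a, b⟩ = 0` at `y`, `h1` reads `2⟨∇a, a⟩⟨b, b⟩ + 2⟨a, a⟩⟨∇b, b⟩ = 0`. Since both norms are
  -- `±1`, this is the claim up to a factor `±2`.
  rcases h.frame.left_self with e | e <;> rcases h.frame.right_self with e' | e' <;>
    simp only [e, e'] at h1 ⊢ <;> norm_num at h1 ⊢ <;> linarith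

/-- Replacing a vector by its tangential part. -/
theorem sub_tangent_normal (w : Coord m) (t : Coord n)
    (ht : ∀ v, G (F y) (fderiv ℝ F y t) (fderiv ℝ F y v) = G (F y) w (fderiv ℝ F y v)) :
    ∃ N, w = fderiv ℝ F y t + N ∧
      N = (G (F y) (a y) (a y) * G (F y) w (a y)) • a y +
      (G (F y) (b y) (b y) * G (F y) w (b y)) • b y := by
  refine ⟨w - fderiv ℝ F y t, by abel, ?_⟩
  refine (h.frame.eq_of_normal (h.symm _) (w - fderiv ℝ F y t) fun v => by simp [ht]).trans ?_
  simp [h.symm _ (fderiv ℝ F y t), h.frame.normal_left, h.frame.normal_right]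

/-- Leibniz rule for `-A(a, b, dF v, dF w)`, with the ambient derivative of each argument split into
tangential and normal parts. Apart from the shape terms, the tangential parts cancel the Christoffel
terms of the induced connection; the normal parts vanish by alternation or by
`trace_normal_connection`. -/
theorem covDeriv_form (A : Coord m → Coord m [⋀^Fin 4]→L[ℝ] ℝ)
    (hA : DifferentiableAt ℝ A (F y)) (Ω : Coord n → Coord n [⋀^Fin 2]→L[ℝ] ℝ)
    (hΩ : ∀ᶠ x in nhds y, ∀ v w,
      Ω x ![v, w] = -A (F x) ![a x, b x, fderiv ℝ F x v, fderiv ℝ F x w]) (u v w : Coord n) :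
    covDeriv (pullbackForm G F) Ω y u ![v, w] =
      -(covDeriv G A (F y) (fderiv ℝ F y u) ![a y, b y, fderiv ℝ F y v, fderiv ℝ F y w] +
        A (F y) ![fderiv ℝ F y (shape G F y a u), b y, fderiv ℝ F y v, fderiv ℝ F y w] +
        A (F y) ![a y, fderiv ℝ F y (shape G F y b u), fderiv ℝ F y v, fderiv ℝ F y w]) := by
  have hA' : DifferentiableAt ℝ (fun x => A (F x)) y := hA.fun_comp' y h.differentiableAt
  have hAu : fderiv ℝ (fun x => A (F x)) y u = fderiv ℝ A (F y) (fderiv ℝ F y u) := by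
    rw [fderiv_fun_comp y hA h.differentiableAt]
    rfl
  let g : Coord n → Coord n → Fin 4 → Coord n → Coord m := fun v w =>
    ![a, b, fun x => fderiv ℝ F x v, fun x => fderiv ℝ F x w]
  have hg : ∀ v w i, DifferentiableAt ℝ (g v w i) y := fun v w i => by
    fin_cases i
    · exact h.differentiableAt_left
    · exact h.differentiableAt_right
    · exact differentiableAt_fderiv_apply h.contDiffAt v
    · exact differentiableAt_fderiv_apply h.contDiffAt w
  have hgx : ∀ v w x, (fun i => g v w i x) = ![a x, b x, fderiv ℝ F x v, fderiv ℝ F x w] :=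
    fun v w x => by ext1 i; fin_cases i <;> rfl
  have hΩ' : ∀ v w, (fun x => Ω x ![v, w]) =ᶠ[nhds y] fun x => -A (F x) (g v w · x) :=
    fun v w => hΩ.mono fun x hx => by
      beta_reduce
      rw [hx, hgx]
  have hdiff : DifferentiableAt ℝ Ω y := differentiableAt_form_of_apply fun v => by
    have hv : v = ![v 0, v 1] := by ext1 i; fin_cases i <;> rfl
    rw [hv]
    exact ((hA'.continuousAlternatingMap_apply (hg (v 0) (v 1))).fun_neg).congr_of_eventuallyEq
      (hΩ' _ _)
  have hder : fderiv ℝ Ω y u ![v, w] = -(fderiv ℝ A (F y) (fderiv ℝ F y u)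
      ![a y, b y, fderiv ℝ F y v, fderiv ℝ F y w] +
      (A (F y) ![fderiv ℝ a y u, b y, fderiv ℝ F y v, fderiv ℝ F y w] +
      A (F y) ![a y, fderiv ℝ b y u, fderiv ℝ F y v, fderiv ℝ F y w] +
      A (F y) ![a y, b y, fderiv ℝ (fun x => fderiv ℝ F x v) y u, fderiv ℝ F y w] +
      A (F y) ![a y, b y, fderiv ℝ F y v, fderiv ℝ (fun x => fderiv ℝ F x w) y u])) := by
    have h1 : fderiv ℝ (fun x => Ω x ![v, w]) y u = fderiv ℝ Ω y u ![v, w] := by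
      rw [(hdiff.hasFDerivAt.continuousAlternatingMap_apply_const ![v, w]).fderiv]
      rfl
    rw [← h1, (hΩ' v w).fderiv_eq, fderiv_fun_neg, neg_apply,
      fderiv_continuousAlternatingMap_apply_apply hA' (hg v w), hAu, hgx, Fin.sum_univ_four,
      update_four_zero, update_four_one, update_four_two, update_four_three]
    rfl
  -- The difference is written as a sum with the scalar `-1`, so that additivity and homogeneity of
  -- `A` in each slot suffice to expand it.
  have hcov : ∀ s : Coord n → Coord m, fderiv ℝ s y u = covAlong G F y s u +
      (-1 : ℝ) • christoffel G (F y) (fderiv ℝ F y u) (s y) := fun s => by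
    rw [covAlong, neg_one_smul]
    abel
  have htan := fun v w => apply_covAlong_fderiv h.symm h.nondegenerate h.differentiableAt_metric
    h.contDiffAt h.pullback_nondegenerate u v w
  -- Each `Nᵢ` is the normal part of one of the four derivatives. In slots three and four it repeats
  -- `a` or `b` and contributes nothing; in slots one and two only its `a`-component, respectively
  -- its `b`-component, survives.
  obtain ⟨N₁, h₁, hN₁⟩ := h.sub_tangent_normal (covAlong G F y a u) _ (h.apply_shape u)
  obtain ⟨N₂, h₂, hN₂⟩ := h.sub_tangent_normal (covAlong G F y b u) _ (h.swap.apply_shape u)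
  obtain ⟨N₃, h₃, hN₃⟩ := h.sub_tangent_normal (covAlong G F y (fun x => fderiv ℝ F x v) u)
    (christoffel (pullbackForm G F) y u v) fun w => (htan v w).symm
  obtain ⟨N₄, h₄, hN₄⟩ := h.sub_tangent_normal (covAlong G F y (fun x => fderiv ℝ F x w) u)
    (christoffel (pullbackForm G F) y u w) fun v => (htan w v).symm
  have e₁ : A (F y) ![N₁, b y, fderiv ℝ F y v, fderiv ℝ F y w] =
      G (F y) (a y) (a y) * G (F y) (covAlong G F y a u) (a y) *
        A (F y) ![a y, b y, fderiv ℝ F y v, fderiv ℝ F y w] := by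
    rw [hN₁, form_add_zero, form_smul_zero, form_smul_zero, form_eq_zero_zero_one]
    ring
  have e₂ : A (F y) ![a y, N₂, fderiv ℝ F y v, fderiv ℝ F y w] =
      G (F y) (b y) (b y) * G (F y) (covAlong G F y b u) (b y) *
        A (F y) ![a y, b y, fderiv ℝ F y v, fderiv ℝ F y w] := by
    rw [hN₂, form_add_one, form_smul_one, form_smul_one, form_eq_zero_zero_one]
    ring
  have e₃ : A (F y) ![a y, b y, N₃, fderiv ℝ F y w] = 0 := by
    rw [hN₃, form_add_two, form_smul_two, form_smul_two, form_eq_zero_zero_two,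
      form_eq_zero_one_two]
    ring
  have e₄ : A (F y) ![a y, b y, fderiv ℝ F y v, N₄] = 0 := by
    rw [hN₄, form_add_three, form_smul_three, form_smul_three, form_eq_zero_zero_three,
      form_eq_zero_one_three]
    ring
  have htr := h.trace_normal_connection u
  rw [covDeriv_two, covDeriv_four, hder, hΩ.self_of_nhds, hΩ.self_of_nhds, hcov a, hcov b,
    hcov (fun x => fderiv ℝ F x v), hcov (fun x => fderiv ℝ F x w), h₁, h₂, h₃, h₄]
  simp only [form_add_zero, form_add_one, form_add_two, form_add_three, form_smul_zero,
    form_smul_one, form_smul_two, form_smul_three, e₁, e₂, e₃, e₄]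
  linear_combination (-A (F y) ![a y, b y, fderiv ℝ F y v, fderiv ℝ F y w]) * htr

/-- The ambient inverse metric is the sum of the induced inverse metric and the normal part. -/
theorem isInverseFamily_elim {e s : Fin n → Coord n}
    (hfamM : IsInverseFamily (pullbackForm G F y).toBilinForm e s) :
    IsInverseFamily (G (F y)).toBilinForm
      (Sum.elim (fun i => fderiv ℝ F y (e i)) ![a y, b y])
      (Sum.elim (fun i => fderiv ℝ F y (s i))
        ![G (F y) (a y) (a y) • a y, G (F y) (b y) (b y) • b y]) := by
  intro w
  rw [← sub_eq_zero]
  have ha := h.frame.left_sq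
  have hb := h.frame.right_sq
  have hab := h.frame.inner_eq_zero
  have hba := h.swap.frame.inner_eq_zero
  have hna := h.frame.normal_left
  have hnb := h.frame.normal_right
  have hna' : ∀ v, G (F y) (fderiv ℝ F y v) (a y) = 0 := fun v => by rw [h.symm, hna]
  have hnb' : ∀ v, G (F y) (fderiv ℝ F y v) (b y) = 0 := fun v => by rw [h.symm, hnb]
  -- The difference is tested against `a`, `b` and tangent vectors. The first two tests only use
  -- `⟨a, a⟩² = ⟨b, b⟩² = 1`; the third is the swapped inverse family of the induced metric.
  refine h.frame.span _ ?_ ?_ fun v => ?_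
  · simp only [Fintype.sum_sum_type, Sum.elim_inl, Sum.elim_inr, Fin.sum_univ_two,
      Matrix.cons_val_zero, Matrix.cons_val_one, map_sub, map_add, map_sum, map_smul, sub_apply,
      add_apply, sum_apply, smul_apply, smul_eq_mul, ContinuousLinearMap.toBilinForm_apply, hna',
      hba, mul_zero, Finset.sum_const_zero]
    linear_combination (G (F y) (a y) w) * ha - h.symm (F y) w (a y)
  · simp only [Fintype.sum_sum_type, Sum.elim_inl, Sum.elim_inr, Fin.sum_univ_two,
      Matrix.cons_val_zero, Matrix.cons_val_one, map_sub, map_add, map_sum, map_smul, sub_apply,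
      add_apply, sum_apply, smul_apply, smul_eq_mul, ContinuousLinearMap.toBilinForm_apply, hnb',
      hab, mul_zero, Finset.sum_const_zero]
    linear_combination (G (F y) (b y) w) * hb - h.symm (F y) w (b y)
  · have hv := congrArg (fun t => G (F y) w (fderiv ℝ F y t))
      (hfamM.swap h.pullback_symm h.pullback_nondegenerate v)
    simp only [map_sum, map_smul, smul_eq_mul, ContinuousLinearMap.toBilinForm_apply,
      pullbackForm_apply] at hv
    simp only [Fintype.sum_sum_type, Sum.elim_inl, Sum.elim_inr, Fin.sum_univ_two,
      Matrix.cons_val_zero, Matrix.cons_val_one, map_sub, map_add, map_sum, map_smul, sub_apply,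
      add_apply, sum_apply, smul_apply, smul_eq_mul, ContinuousLinearMap.toBilinForm_apply, hna,
      hnb, mul_zero, add_zero]
    rw [← hv, sub_eq_zero]
    refine Finset.sum_congr rfl fun i _ => ?_
    rw [h.symm _ w, mul_comm]

/-- The induced form is coclosed at `y` if the ambient form is coclosed at `F y`. -/
theorem sum_covDeriv_form (A : Coord m → Coord m [⋀^Fin 4]→L[ℝ] ℝ)
    (hA : DifferentiableAt ℝ A (F y)) (Ω : Coord n → Coord n [⋀^Fin 2]→L[ℝ] ℝ)
    (hΩ : ∀ᶠ x in nhds y, ∀ v w,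
      Ω x ![v, w] = -A (F x) ![a x, b x, fderiv ℝ F x v, fderiv ℝ F x w])
    (hco : ∀ p q r, ∑ i : Fin m, covDeriv G A (F y) (EuclideanSpace.single i 1)
      ![sharp G (F y) (EuclideanSpace.proj i), p, q, r] = 0) (w : Coord n) :
    ∑ i : Fin n, covDeriv (pullbackForm G F) Ω y (EuclideanSpace.single i 1)
      ![sharp (pullbackForm G F) y (EuclideanSpace.proj i), w] = 0 := by
  have hfamM := isInverseFamily_sharp (G := pullbackForm G F) (y := y) h.pullback_symm
    h.pullback_nondegenerate
  have hfamN := isInverseFamily_sharp (G := G) (y := F y) (h.symm _) h.nondegenerate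
  set e : Fin n → Coord n := fun i => EuclideanSpace.single i 1
  set s : Fin n → Coord n := fun i => sharp (pullbackForm G F) y (EuclideanSpace.proj i)
  let T := covDerivBilin G A (F y) (a y) (b y) (fderiv ℝ F y w)
  have hT : ∑ i : Fin m, T (EuclideanSpace.single i 1)
      (sharp G (F y) (EuclideanSpace.proj i)) = 0 :=
    (Finset.sum_congr rfl fun i _ => (covDeriv_cycle _ _ _ _ _ _).symm).trans
      (hco (a y) (b y) (fderiv ℝ F y w))
  -- The normal directions contribute nothing to the ambient trace, because `a` and `b` already
  -- occupy two slots. Hence the tangential trace in `h1` equals the full trace.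
  have ha : ∀ r : ℝ, T (a y) (r • a y) = 0 := fun r => by
    rw [map_smul, covDerivBilin_apply, covDeriv_eq_zero_left, smul_zero]
  have hb : ∀ r : ℝ, T (b y) (r • b y) = 0 := fun r => by
    rw [map_smul, covDerivBilin_apply, covDeriv_eq_zero_right, smul_zero]
  have key := (h.isInverseFamily_elim hfamM).sum_eq hfamN (h.symm _) h.nondegenerate T
  have h1 : ∑ i, covDeriv G A (F y) (fderiv ℝ F y (e i))
      ![a y, b y, fderiv ℝ F y (s i), fderiv ℝ F y w] = 0 := by
    rw [hT, Fintype.sum_sum_type, Fin.sum_univ_two] at key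
    simp only [Sum.elim_inl, Sum.elim_inr, Matrix.cons_val_zero, Matrix.cons_val_one, ha, hb,
      add_zero] at key
    exact key
  let T₁ : Coord n →ₗ[ℝ] Coord n →ₗ[ℝ] ℝ := LinearMap.mk₂ ℝ
    (fun u v => A (F y) ![fderiv ℝ F y u, b y, fderiv ℝ F y v, fderiv ℝ F y w])
    (fun u u' v => by simp only [map_add, form_add_zero])
    (fun r u v => by simp only [map_smul, form_smul_zero, smul_eq_mul])
    (fun u v v' => by simp only [map_add, form_add_two])
    (fun r u v => by simp only [map_smul, form_smul_two, smul_eq_mul])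
  let T₂ : Coord n →ₗ[ℝ] Coord n →ₗ[ℝ] ℝ := LinearMap.mk₂ ℝ
    (fun u v => A (F y) ![a y, fderiv ℝ F y u, fderiv ℝ F y v, fderiv ℝ F y w])
    (fun u u' v => by simp only [map_add, form_add_one])
    (fun r u v => by simp only [map_smul, form_smul_one, smul_eq_mul])
    (fun u v v' => by simp only [map_add, form_add_two])
    (fun r u v => by simp only [map_smul, form_smul_two, smul_eq_mul])
  -- Trace of a self-adjoint shape operator against a form that is skew in its two free slots.
  have h2 : ∑ i, A (F y) ![fderiv ℝ F y (shape G F y a (e i)), b y, fderiv ℝ F y (s i),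
      fderiv ℝ F y w] = 0 :=
    hfamM.sum_skew h.pullback_symm h.pullback_nondegenerate T₁
      (fun u v => form_swap_zero_two _ _ _ _ _) (shape G F y a) h.shape_symm
  have h3 : ∑ i, A (F y) ![a y, fderiv ℝ F y (shape G F y b (e i)), fderiv ℝ F y (s i),
      fderiv ℝ F y w] = 0 :=
    hfamM.sum_skew h.pullback_symm h.pullback_nondegenerate T₂
      (fun u v => form_swap_one_two _ _ _ _ _) (shape G F y b) h.swap.shape_symm
  simp only [h.covDeriv_form A hA Ω hΩ]
  rw [Finset.sum_neg_distrib, Finset.sum_add_distrib, Finset.sum_add_distrib, h1, h2, h3]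
  simp

end IsNormalFrameAt

end NormalFrame

/-! ### Passage to charts -/

section Charts

variable {n : ℕ} {M : Type*} [TopologicalSpace M] [ChartedSpace (Coord n) M]

theorem extChartAt_symm_extChartAt {x₀ x : M} (hx : x ∈ (chartAt (Coord n) x₀).source) :
    (extChartAt (𝓡 n) x₀).symm (extChartAt (𝓡 n) x₀ x) = x :=
  (extChartAt (𝓡 n) x₀).left_inv (by rwa [extChartAt_source])

variable [IsManifold (𝓡 n) ∞ M]

theorem metricInChart_extChartAt (g : BilinField n M) {x₀ x : M}
    (hx : x ∈ (chartAt (Coord n) x₀).source) (u v : Coord n) :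
    metricInChart g x₀ (extChartAt (𝓡 n) x₀ x) u v =
      g x (coordFrame x₀ x u) (coordFrame x₀ x v) :=
  congrArg (fun z => g z (coordFrame x₀ z u) (coordFrame x₀ z v)) (extChartAt_symm_extChartAt hx)

theorem formInChart_extChartAt {k : ℕ} (α : FormField n M k) {x₀ x : M}
    (hx : x ∈ (chartAt (Coord n) x₀).source) (v : Fin k → Coord n) :
    formInChart α x₀ (extChartAt (𝓡 n) x₀ x) v = α x fun i => coordFrame x₀ x (v i) :=
  congrArg (fun z => α z fun i => coordFrame x₀ z (v i)) (extChartAt_symm_extChartAt hx)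

theorem continuousLinearMapAt_coordFrame {x₀ x : M} (hx : x ∈ (chartAt (Coord n) x₀).source)
    (u : Coord n) : (trivializationAt (Coord n) (TangentSpace (𝓡 n)) x₀).continuousLinearMapAt ℝ x
      (coordFrame x₀ x u) = u :=
  (trivializationAt (Coord n) (TangentSpace (𝓡 n)) x₀).continuousLinearMapAt_symmL
    (by simpa using hx) u

theorem coordFrame_continuousLinearMapAt {x₀ x : M} (hx : x ∈ (chartAt (Coord n) x₀).source)
    (v : TangentSpace (𝓡 n) x) : coordFrame x₀ x
      ((trivializationAt (Coord n) (TangentSpace (𝓡 n)) x₀).continuousLinearMapAt ℝ x v) = v :=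
  (trivializationAt (Coord n) (TangentSpace (𝓡 n)) x₀).symmL_continuousLinearMapAt
    (by simpa using hx) v

/-- In the trivialization at `x₀` this field is the constant `u`. -/
theorem contMDiffAt_coordFrame (x₀ : M) (u : Coord n) :
    ContMDiffAt (𝓡 n) ((𝓡 n).prod 𝓘(ℝ, Coord n)) ∞
      (fun x => (⟨x, coordFrame x₀ x u⟩ : TangentBundle (𝓡 n) M)) x₀ := by
  refine (contMDiffAt_section (IB := 𝓡 n) (n := ∞) (F := Coord n)
    (E := fun x : M => TangentSpace (𝓡 n) x) (s := fun x => coordFrame x₀ x u) x₀).2 ?_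
  refine (contMDiffAt_const (c := u)).congr_of_eventuallyEq ?_
  filter_upwards [(chartAt (Coord n) x₀).open_source.mem_nhds (mem_chart_source _ x₀)] with x hx
  have := continuousLinearMapAt_coordFrame hx u
  rwa [Bundle.Trivialization.continuousLinearMapAt_apply,
    Bundle.Trivialization.linearMapAt_apply, if_pos (by simpa using hx)] at this

theorem differentiableAt_comp_extChartAt_symm {f : M → ℝ} {x₀ : M}
    (hf : ContMDiffAt (𝓡 n) 𝓘(ℝ, ℝ) ∞ f x₀) :
    DifferentiableAt ℝ (fun y => f ((extChartAt (𝓡 n) x₀).symm y)) (extChartAt (𝓡 n) x₀ x₀) := by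
  have h1 : ContMDiffAt 𝓘(ℝ, Coord n) (𝓡 n) ∞ (extChartAt (𝓡 n) x₀).symm
      (extChartAt (𝓡 n) x₀ x₀) :=
    (contMDiffOn_extChartAt_symm x₀).contMDiffAt (extChartAt_target_mem_nhds x₀)
  have h2 : ContMDiffAt (𝓡 n) 𝓘(ℝ, ℝ) ∞ f
      ((extChartAt (𝓡 n) x₀).symm (extChartAt (𝓡 n) x₀ x₀)) := by
    rwa [extChartAt_to_inv]
  exact (h2.comp _ h1).contDiffAt.differentiableAt (by simp)

theorem PseudoRiemannianMetric.contMDiffAt_apply (h : PseudoRiemannianMetric n M) {x₀ : M}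
    {v w : ∀ x : M, TangentSpace (𝓡 n) x}
    (hv : ContMDiffAt (𝓡 n) ((𝓡 n).prod 𝓘(ℝ, Coord n)) ∞
      (fun x => (⟨x, v x⟩ : TangentBundle (𝓡 n) M)) x₀)
    (hw : ContMDiffAt (𝓡 n) ((𝓡 n).prod 𝓘(ℝ, Coord n)) ∞
      (fun x => (⟨x, w x⟩ : TangentBundle (𝓡 n) M)) x₀) :
    ContMDiffAt (𝓡 n) 𝓘(ℝ, ℝ) ∞ (fun x => h.val x (v x) (w x)) x₀ := by
  -- The function is regarded as a section of the trivial line bundle, where smooth bundle maps can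
  -- be applied to smooth sections; its second component is the function itself.
  have : ContMDiffAt (𝓡 n) ((𝓡 n).prod 𝓘(ℝ, ℝ)) ∞
      (fun x => TotalSpace.mk' ℝ (E := Bundle.Trivial M ℝ) x (h.val x (v x) (w x))) x₀ :=
    ContMDiffAt.clm_bundle_apply₂ (F₁ := Coord n) (F₂ := Coord n) (F₃ := ℝ)
      (E₁ := fun x : M => TangentSpace (𝓡 n) x) (E₂ := fun x : M => TangentSpace (𝓡 n) x)
      (E₃ := Bundle.Trivial M ℝ) (b := id) h.contMDiff.contMDiffAt hv hw
  simp only [contMDiffAt_totalSpace] at this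
  exact this.2

theorem differentiableAt_metricInChart (h : PseudoRiemannianMetric n M) (x₀ : M) :
    DifferentiableAt ℝ (metricInChart h.val x₀) (extChartAt (𝓡 n) x₀ x₀) :=
  differentiableAt_of_apply fun u => differentiableAt_of_apply fun v =>
    differentiableAt_comp_extChartAt_symm
      (h.contMDiffAt_apply (contMDiffAt_coordFrame x₀ u) (contMDiffAt_coordFrame x₀ v))

theorem differentiableAt_formInChart {r : ℕ} {h : PseudoRiemannianMetric n M}
    (X : VectorCrossProduct r h) (x₀ : M) :
    DifferentiableAt ℝ (formInChart X.form x₀) (extChartAt (𝓡 n) x₀ x₀) :=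
  differentiableAt_form_of_apply fun v =>
    differentiableAt_comp_extChartAt_symm
      (h.contMDiffAt_apply ((X.contMDiffOn x₀ fun i => v i.castSucc).contMDiffAt
        ((chartAt (Coord n) x₀).open_source.mem_nhds (mem_chart_source _ x₀)))
        (contMDiffAt_coordFrame x₀ (v (Fin.last r))))

theorem metricInChart_nondegenerate (h : PseudoRiemannianMetric n M) {x₀ x : M}
    (hx : x ∈ (chartAt (Coord n) x₀).source) (v : Coord n)
    (hv : ∀ w, metricInChart h.val x₀ (extChartAt (𝓡 n) x₀ x) v w = 0) : v = 0 := by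
  simp only [metricInChart_extChartAt _ hx] at hv
  have h0 : coordFrame x₀ x v = 0 := by
    refine h.nondegenerate x _ fun w => ?_
    rw [← coordFrame_continuousLinearMapAt hx w]
    exact hv _
  rw [← continuousLinearMapAt_coordFrame hx v, h0, map_zero]

end Charts

/-! ### Smooth maps and their differentials read in charts -/

section MapInCharts

variable {n m : ℕ} {M : Type*} [TopologicalSpace M] [ChartedSpace (Coord n) M]
  [IsManifold (𝓡 n) ∞ M] {N : Type*} [TopologicalSpace N] [ChartedSpace (Coord m) N]
  [IsManifold (𝓡 m) ∞ N]

/-- The map `f` in the preferred charts at `p` and `f p`. -/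
def mapInCharts (n m : ℕ) {M : Type*} [TopologicalSpace M] [ChartedSpace (Coord n) M]
    {N : Type*} [TopologicalSpace N] [ChartedSpace (Coord m) N] (f : M → N) (p : M) (y : Coord n) : Coord m :=
  extChartAt (𝓡 m) (f p) (f ((extChartAt (𝓡 n) p).symm y))

theorem contDiffAt_mapInCharts {f : M → N} (hf : ContMDiff (𝓡 n) (𝓡 m) ∞ f) {p x : M}
    (hx : x ∈ (chartAt (Coord n) p).source) (hfx : f x ∈ (chartAt (Coord m) (f p)).source) :
    ContDiffAt ℝ ∞ (mapInCharts n m f p) (extChartAt (𝓡 n) p x) := by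
  have hx' := extChartAt_symm_extChartAt hx
  have h1 : ContMDiffAt 𝓘(ℝ, Coord n) (𝓡 n) ∞ (extChartAt (𝓡 n) p).symm
      (extChartAt (𝓡 n) p x) :=
    (contMDiffOn_extChartAt_symm p).contMDiffAt
      (extChartAt_target_mem_nhds' ((extChartAt (𝓡 n) p).map_source (by rwa [extChartAt_source])))
  have h2 : ContMDiffAt (𝓡 m) 𝓘(ℝ, Coord m) ∞ (extChartAt (𝓡 m) (f p)) (f x) :=
    contMDiffAt_extChartAt' hfx
  unfold mapInCharts
  rw [← hx'] at h2
  have h3 : ContMDiffAt 𝓘(ℝ, Coord n) (𝓡 m) ∞ (fun y => f ((extChartAt (𝓡 n) p).symm y))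
      (extChartAt (𝓡 n) p x) := hf.contMDiffAt.comp (extChartAt (𝓡 n) p x) h1
  exact (h2.comp (extChartAt (𝓡 n) p x) h3).contDiffAt

/-- The coordinate frame is the derivative of the inverse chart and the trivialization is the
derivative of the chart, so this is the chain rule. It is needed at all points near `p`, since
metrics and forms get differentiated. -/
theorem mfderiv_coordFrame {f : M → N} (hf : ContMDiff (𝓡 n) (𝓡 m) ∞ f) {p x : M}
    (hx : x ∈ (chartAt (Coord n) p).source) (hfx : f x ∈ (chartAt (Coord m) (f p)).source)
    (u : Coord n) : mfderiv (𝓡 n) (𝓡 m) f x (coordFrame p x u) =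
      coordFrame (f p) (f x) (fderiv ℝ (mapInCharts n m f p) (extChartAt (𝓡 n) p x) u) := by
  have hx' := extChartAt_symm_extChartAt hx
  rw [← coordFrame_continuousLinearMapAt hfx (mfderiv (𝓡 n) (𝓡 m) f x (coordFrame p x u))]
  congr 1
  rw [TangentBundle.continuousLinearMapAt_trivializationAt hfx, coordFrame,
    TangentBundle.symmL_trivializationAt hx, ← mfderiv_eq_fderiv]
  have h1 : MDifferentiableAt 𝓘(ℝ, Coord n) (𝓡 n) (extChartAt (𝓡 n) p).symm
      (extChartAt (𝓡 n) p x) :=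
    ((contMDiffOn_extChartAt_symm (n := ∞) p).contMDiffAt (extChartAt_target_mem_nhds'
      ((extChartAt (𝓡 n) p).map_source (by rwa [extChartAt_source])))).mdifferentiableAt (by simp)
  have h2 : HasMFDerivAt (𝓡 m) 𝓘(ℝ, Coord m) (extChartAt (𝓡 m) (f p)) (f x)
      (mfderiv (𝓡 m) 𝓘(ℝ, Coord m) (extChartAt (𝓡 m) (f p)) (f x)) :=
    (mdifferentiableAt_extChartAt hfx).hasMFDerivAt
  have h3 : HasMFDerivAt (𝓡 n) (𝓡 m) f x (mfderiv (𝓡 n) (𝓡 m) f x) :=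
    (hf.contMDiffAt.mdifferentiableAt (by simp)).hasMFDerivAt
  let D : Coord n →L[ℝ] Coord m :=
    (mfderiv (𝓡 m) 𝓘(ℝ, Coord m) (extChartAt (𝓡 m) (f p)) (f x)).comp
      (mfderiv (𝓡 n) (𝓡 m) f x)
  -- Going into the chart and back returns `x` only up to a propositional equality. With `D` typed
  -- on coordinate spaces, the derivative can be transported along it.
  have h4 : ∀ z, z = x →
      HasMFDerivAt (𝓡 n) 𝓘(ℝ, Coord m) (extChartAt (𝓡 m) (f p) ∘ f) z D := by
    intro z hz
    subst hz
    exact h2.comp z h3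
  have h5 : HasMFDerivAt 𝓘(ℝ, Coord n) 𝓘(ℝ, Coord m) (mapInCharts n m f p) (extChartAt (𝓡 n) p x)
      (D.comp (mfderiv 𝓘(ℝ, Coord n) (𝓡 n) (extChartAt (𝓡 n) p).symm (extChartAt (𝓡 n) p x))) :=
    HasMFDerivAt.comp (g := extChartAt (𝓡 m) (f p) ∘ f) _ (h4 _ hx') h1.hasMFDerivAt
  rw [h5.mfderiv, ModelWithCorners.Boundaryless.range_eq_univ, mfderivWithin_univ]
  rfl

end MapInCharts

/-! ### Oriented normal frames -/

section Orientation

variable {n m : ℕ}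

/-- The determinant of `(u, v, D e₁, …, D eₙ)`. -/
def frameDet (e : Basis (Fin n) ℝ (Coord n)) (E : Basis (Fin (n + 2)) ℝ (Coord (n + 2)))
    (D : Coord n →L[ℝ] Coord (n + 2)) (u v : Coord (n + 2)) : ℝ :=
  E.det (Matrix.vecCons u (Matrix.vecCons v (D ∘ e)))

variable {e : Basis (Fin n) ℝ (Coord n)} {E : Basis (Fin (n + 2)) ℝ (Coord (n + 2))}
  {D : Coord n →L[ℝ] Coord (n + 2)}

/-- With the tangent vectors fixed, the determinant is an alternating bilinear form of its first two
arguments. -/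
theorem frameDet_combination (α β : Coord (n + 2)) (x z x' z' : ℝ) :
    frameDet e E D (x • α + z • β) (x' • α + z' • β) =
      (x * z' - z * x') * frameDet e E D α β := by
  have h : ∀ u v, frameDet e E D u v = (E.det.curryLeft u).curryLeft v (D ∘ e) := fun u v => rfl
  have h0 : ∀ u, frameDet e E D u u = 0 := fun u =>
    E.det.map_eq_zero_of_eq _ (i := 0) (j := 1) rfl (by simp)
  have h1 : frameDet e E D β α = -frameDet e E D α β := by
    have := h0 (α + β)
    have ha := h0 α
    have hb := h0 β
    simp only [h, map_add, AlternatingMap.add_apply, AlternatingMap.curryLeft_add,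
      LinearMap.add_apply] at *
    linarith
  have ha := h0 α
  have hb := h0 β
  simp only [h, map_add, map_smul, AlternatingMap.add_apply, AlternatingMap.smul_apply,
    AlternatingMap.curryLeft_add, AlternatingMap.curryLeft_smul, LinearMap.add_apply,
    LinearMap.smul_apply, smul_eq_mul] at *
  rw [ha, hb, h1]
  ring

/-- The sign of `frameDet` only depends on the orientation of the basis of the domain. -/
theorem frameDet_pos_of_orientation_eq {e' : Basis (Fin n) ℝ (Coord n)}
    (he : e'.orientation = e.orientation) {α β : Coord (n + 2)}
    (h : 0 < frameDet e' E D α β) : 0 < frameDet e E D α β := by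
  let ψ : Coord n [⋀^Fin n]→ₗ[ℝ] ℝ :=
    ((E.det.curryLeft α).curryLeft β).compLinearMap D.toLinearMap
  have h1 : frameDet e E D α β = ψ e := rfl
  have h2 : frameDet e' E D α β = ψ e' := rfl
  -- A form of top degree is its value on `e'` times the determinant relative to `e'`, and equally
  -- oriented bases have positive relative determinant.
  rw [h1, ψ.eq_smul_basis_det e']
  exact mul_pos (h2 ▸ h) ((e'.orientation_eq_iff_det_pos e).1 he)

/-- Ensures that a continuous normal frame which is positive at one point stays positive nearby. -/
theorem continuousAt_frameDet {Y : Type*} [TopologicalSpace Y] {y : Y}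
    {D : Y → Coord n →L[ℝ] Coord (n + 2)} {a b : Y → Coord (n + 2)} (hD : ContinuousAt D y)
    (ha : ContinuousAt a y) (hb : ContinuousAt b y) :
    ContinuousAt (fun x => frameDet e E (D x) (a x) (b x)) y := by
  refine (continuous_multilinear E.det.toMultilinearMap).continuousAt.comp
    (f := fun x => Matrix.vecCons (a x) (Matrix.vecCons (b x) (D x ∘ e))) ?_
  refine continuousAt_pi.2 fun i => ?_
  refine Fin.cases ha (fun j => ?_) i
  refine Fin.cases hb (fun k => ?_) j
  exact hD.clm_apply continuousAt_const

/-- Two equally oriented frames of the normal plane with equal Gram determinants up to sign have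
the same bivector. -/
theorem form_eq_of_frames {B : Coord (n + 2) →L[ℝ] Coord (n + 2) →L[ℝ] ℝ}
    (hs : ∀ v w, B v w = B w v) {α β a b : Coord (n + 2)}
    (h : IsOrthonormalComplement B D α β) (ha : ∀ v, B a (D v) = 0) (hb : ∀ v, B b (D v) = 0)
    (hgram : (B a a * B b b - B a b ^ 2) ^ 2 = 1)
    (hpos : 0 < frameDet e E D α β) (hpos' : 0 < frameDet e E D a b)
    (A : Coord (n + 2) [⋀^Fin 4]→L[ℝ] ℝ) (p q : Coord (n + 2)) :
    A ![α, β, p, q] = A ![a, b, p, q] := by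
  have h1 := h.eq_of_normal hs a ha
  have h2 := h.eq_of_normal hs b hb
  have h3 := h.left_sq
  have h4 := h.right_sq
  have h5 := h.inner_eq_zero
  have h6 := (h.swap hs).inner_eq_zero
  -- The scalars `x`, `z` and `x'`, `z'` are the coordinates of `a` and `b` in the frame `α`, `β`.
  generalize B α α * B a α = x at *
  generalize B β β * B a β = z at *
  generalize B α α * B b α = x' at *
  generalize B β β * B b β = z' at *
  subst h1 h2
  rw [frameDet_combination] at hpos'
  have hD : 0 < x * z' - z * x' := (pos_iff_pos_of_mul_pos hpos').2 hpos
  have hD1 : x * z' - z * x' = 1 := by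
    simp only [map_add, map_smul, add_apply, smul_apply, smul_eq_mul, h5, h6] at hgram
    -- The Gram determinant of `a`, `b` is the square of the change-of-frame determinant times `⟨α,
    -- α⟩⟨β, β⟩ = ±1`; squaring removes the sign. Positivity of the determinant then leaves only the
    -- root `1`.
    have : (x * z' - z * x') ^ 4 = 1 := by
      linear_combination hgram - (x * z' - z * x') ^ 4 * (B β β * B β β) * h3 -
        (x * z' - z * x') ^ 4 * h4
    exact (pow_eq_one_iff_of_nonneg hD.le (by norm_num)).1 this
  simp only [form_add_zero, form_add_one, form_smul_zero, form_smul_one, form_eq_zero_zero_one,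
    form_swap_zero_one A α β]
  linear_combination (-A ![α, β, p, q]) * hD1

end Orientation

/-! ### The para-Hermitian form in charts -/

section Immersion

variable {M : Type*} [TopologicalSpace M] [ChartedSpace (Coord 6) M]
  {N : Type*} [TopologicalSpace N] [ChartedSpace (Coord 8) N] {f : M → N}

theorem mapInCharts_extChartAt {p x : M} (hx : x ∈ (chartAt (Coord 6) p).source) :
    mapInCharts 6 8 f p (extChartAt (𝓡 6) p x) = extChartAt (𝓡 8) (f p) (f x) := by
  rw [mapInCharts, extChartAt_symm_extChartAt hx]

variable [IsManifold (𝓡 8) ∞ N] {h : PseudoRiemannianMetric 8 N}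

theorem metricInChart_mapInCharts {p x : M}
    (hx : x ∈ (chartAt (Coord 6) p).source) (hfx : f x ∈ (chartAt (Coord 8) (f p)).source)
    (u v : Coord 8) :
    metricInChart h.val (f p) (mapInCharts 6 8 f p (extChartAt (𝓡 6) p x)) u v =
      h.val (f x) (coordFrame (f p) (f x) u) (coordFrame (f p) (f x) v) := by
  rw [mapInCharts_extChartAt hx, metricInChart_extChartAt _ hfx]

variable [IsManifold (𝓡 6) ∞ M]

theorem coordFrame_fderiv_mapInCharts (hf : IsLorentzNormalImmersion h f) {p x : M}
    (hx : x ∈ (chartAt (Coord 6) p).source) (hfx : f x ∈ (chartAt (Coord 8) (f p)).source)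
    (u : Coord 6) :
    coordFrame (f p) (f x) (fderiv ℝ (mapInCharts 6 8 f p) (extChartAt (𝓡 6) p x) u) =
      differential f x (coordFrame p x u) :=
  (mfderiv_coordFrame hf.contMDiff hx hfx u).symm

/-- Stated at every `x` near `p`, because the Christoffel symbols depend on the germ of the metric
and not only on its value. -/
theorem metricInChart_pullbackMetric (hf : IsLorentzNormalImmersion h f) {p x : M}
    (hx : x ∈ (chartAt (Coord 6) p).source) (hfx : f x ∈ (chartAt (Coord 8) (f p)).source) :
    metricInChart (pullbackMetric h f) p (extChartAt (𝓡 6) p x) =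
      pullbackForm (metricInChart h.val (f p)) (mapInCharts 6 8 f p) (extChartAt (𝓡 6) p x) := by
  ext1 u
  ext1 v
  rw [metricInChart_extChartAt _ hx, pullbackForm_apply, metricInChart_mapInCharts hx hfx,
    coordFrame_fderiv_mapInCharts hf hx hfx, coordFrame_fderiv_mapInCharts hf hx hfx]
  rfl

theorem injective_fderiv_mapInCharts (hf : IsLorentzNormalImmersion h f) {p x : M}
    (hx : x ∈ (chartAt (Coord 6) p).source) (hfx : f x ∈ (chartAt (Coord 8) (f p)).source) :
    Function.Injective (fderiv ℝ (mapInCharts 6 8 f p) (extChartAt (𝓡 6) p x)) := by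
  intro u v huv
  have h1 := congrArg (coordFrame (f p) (f x)) huv
  rw [coordFrame_fderiv_mapInCharts hf hx hfx, coordFrame_fderiv_mapInCharts hf hx hfx] at h1
  rw [← continuousLinearMapAt_coordFrame hx u, hf.injective x h1,
    continuousLinearMapAt_coordFrame hx v]

/-- In charts, the para-Hermitian form is `-μ(α, β, ·, ·)` for an oriented orthonormal normal
frame `α`, `β`. -/
theorem exists_frame_inCharts (X : VectorCrossProduct 3 h) (oM : ManifoldOrientation 6 M)
    (oN : ManifoldOrientation 8 N) (hf : IsLorentzNormalImmersion h f) {p x : M}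
    (hx : x ∈ (chartAt (Coord 6) p).source) (hfx : f x ∈ (chartAt (Coord 8) (f p)).source)
    {e : Basis (Fin 6) ℝ (Coord 6)} {E : Basis (Fin 8) ℝ (Coord 8)}
    (he : ∀ hx' : x ∈ (trivializationAt (Coord 6) (TangentSpace (𝓡 6)) p).baseSet,
      Orientation.map (Fin 6) ((trivializationAt (Coord 6) (TangentSpace (𝓡 6))
        p).continuousLinearEquivAt ℝ x hx').toLinearEquiv (oM.toFun x) = e.orientation)
    (hE : ∀ hx' : f x ∈ (trivializationAt (Coord 8) (TangentSpace (𝓡 8)) (f p)).baseSet,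
      Orientation.map (Fin 8) ((trivializationAt (Coord 8) (TangentSpace (𝓡 8))
        (f p)).continuousLinearEquivAt ℝ (f x) hx').toLinearEquiv (oN.toFun (f x)) =
          E.orientation) :
    ∃ α β, IsOrthonormalComplement
        (metricInChart h.val (f p) (mapInCharts 6 8 f p (extChartAt (𝓡 6) p x)))
        (fderiv ℝ (mapInCharts 6 8 f p) (extChartAt (𝓡 6) p x)) α β ∧
      0 < frameDet e E (fderiv ℝ (mapInCharts 6 8 f p) (extChartAt (𝓡 6) p x)) α β ∧
      ∀ v w, formInChart (paraHermitianForm X oM oN hf) p (extChartAt (𝓡 6) p x) ![v, w] =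
        -formInChart X.form (f p) (mapInCharts 6 8 f p (extChartAt (𝓡 6) p x))
          ![α, β, fderiv ℝ (mapInCharts 6 8 f p) (extChartAt (𝓡 6) p x) v,
            fderiv ℝ (mapInCharts 6 8 f p) (extChartAt (𝓡 6) p x) w] := by
  obtain ⟨a, b, hab, hL⟩ := paracomplexStructure_spec X oM oN hf x
  have hd := coordFrame_fderiv_mapInCharts hf hx hfx
  have hG := metricInChart_mapInCharts (h := h) hx hfx
  set y := extChartAt (𝓡 6) p x
  set D := fderiv ℝ (mapInCharts 6 8 f p) y
  let c := (trivializationAt (Coord 8) (TangentSpace (𝓡 8)) (f p)).continuousLinearMapAt ℝ (f x)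
  have hc : ∀ v, coordFrame (f p) (f x) (c v) = v := coordFrame_continuousLinearMapAt hfx
  have hc' : ∀ v, c (coordFrame (f p) (f x) v) = v := continuousLinearMapAt_coordFrame hfx
  have ha : ∀ v, h.val (f x) a (differential f x v) = 0 :=
    (mem_normalSpace (h.symm (f x))).1 hab.left_mem
  have hb : ∀ v, h.val (f x) b (differential f x v) = 0 :=
    (mem_normalSpace (h.symm (f x))).1 hab.right_mem
  obtain ⟨e', E', he', hE', hcons⟩ := hab.oriented
  refine ⟨c a, c b, ⟨?_, ?_, ?_, ?_, ?_, ?_⟩, ?_, ?_⟩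
  · rw [hG, hc]
    exact hab.left_self
  · rw [hG, hc]
    exact hab.right_self
  · rw [hG, hc, hc]
    exact hab.inner_eq_zero
  · intro v
    rw [hG, hc, hd]
    exact ha _
  · intro v
    rw [hG, hc, hd]
    exact hb _
  · intro w h1 h2 h3
    rw [hG, hc] at h1 h2
    simp only [hG, hd] at h3
    -- The basis `E'` consists of `a`, `b` and the images of `e'`, so a vector orthogonal to the
    -- frame and to the tangent space is orthogonal to everything.
    have h4 : (h.val (f x) (coordFrame (f p) (f x) w)).toLinearMap = 0 := by
      refine E'.ext fun i => ?_
      rw [hcons]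
      refine Fin.cases h1 (fun j => Fin.cases h2 (fun k => ?_) j) i
      have := h3 ((trivializationAt (Coord 6) (TangentSpace (𝓡 6)) p).continuousLinearMapAt ℝ x
        (e' k))
      rw [coordFrame_continuousLinearMapAt hx] at this
      exact this
    have h5 : coordFrame (f p) (f x) w = 0 :=
      h.nondegenerate _ _ fun v => DFunLike.congr_fun h4 v
    rw [← hc' w, h5, map_zero]
  · have hx' : x ∈ (trivializationAt (Coord 6) (TangentSpace (𝓡 6)) p).baseSet := by simpa using hx
    have hfx' : f x ∈ (trivializationAt (Coord 8) (TangentSpace (𝓡 8)) (f p)).baseSet := by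
      simpa using hfx
    have he1 := he hx'
    have hE1 := hE hfx'
    rw [← he', ← Basis.orientation_map] at he1
    rw [← hE', ← Basis.orientation_map] at hE1
    -- The basis `e` may be replaced by `e'` read in the chart; the vectors in the determinant are
    -- then exactly `E'` read in the chart, which has the orientation of `E`.
    refine frameDet_pos_of_orientation_eq he1 ?_
    have h6 := (E.orientation_eq_iff_det_pos _).1 hE1.symm
    have hcons' : ⇑(E'.map ((trivializationAt (Coord 8) (TangentSpace (𝓡 8))
        (f p)).continuousLinearEquivAt ℝ (f x) hfx').toLinearEquiv) =
        Matrix.vecCons (c a) (Matrix.vecCons (c b) (D ∘ e'.map ((trivializationAt (Coord 6)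
          (TangentSpace (𝓡 6)) p).continuousLinearEquivAt ℝ x hx').toLinearEquiv)) := by
      funext i
      have hmap : ∀ v, ((trivializationAt (Coord 8) (TangentSpace (𝓡 8))
          (f p)).continuousLinearEquivAt ℝ (f x) hfx').toLinearEquiv v = c v :=
        congrFun (Bundle.Trivialization.coe_continuousLinearEquivAt_eq _ hfx')
      rw [Basis.map_apply, hcons, hmap]
      refine Fin.cases rfl (fun j => Fin.cases rfl (fun k => ?_) j) i
      have hmap' : ((trivializationAt (Coord 6) (TangentSpace (𝓡 6))
          p).continuousLinearEquivAt ℝ x hx').toLinearEquiv (e' k) =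
          (trivializationAt (Coord 6) (TangentSpace (𝓡 6)) p).continuousLinearMapAt ℝ x (e' k) :=
        congrFun (Bundle.Trivialization.coe_continuousLinearEquivAt_eq _ hx') _
      simp only [Matrix.cons_val_succ, Function.comp_apply, Basis.map_apply]
      rw [hmap', ← hc' (D _), hd, coordFrame_continuousLinearMapAt hx]
      rfl
    rw [hcons'] at h6
    exact h6
  · intro v w
    have h7 := hL (coordFrame p x v)
    have h8 : X.form (f x) (fun i => coordFrame (f p) (f x) (![c a, c b, D v, D w] i)) =
        h.val (f x) (X.toFun (f x) ![a, b, differential f x (coordFrame p x v)])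
          (differential f x (coordFrame p x w)) := by
      rw [← hd v, ← hd w]
      conv_rhs => rw [← hc a, ← hc b]
      refine congrArg₂ (fun s t => h.val (f x) (X.toFun (f x) s) t) ?_ rfl
      funext i
      fin_cases i <;> rfl
    rw [mapInCharts_extChartAt hx, formInChart_extChartAt _ hfx, h8, ← neg_apply, ← map_neg, ← h7,
      formInChart_extChartAt _ hx]
    rfl

end Immersion

/-! ### Differentiable normal frames -/

section SmoothFrame

variable {n m : ℕ} {G : Coord m → Coord m →L[ℝ] Coord m →L[ℝ] ℝ} {F : Coord n → Coord m}
  {y : Coord n}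

/-- The component of the constant vector `w` normal to the image of `F`. -/
def normalPart (G : Coord m → Coord m →L[ℝ] Coord m →L[ℝ] ℝ) (F : Coord n → Coord m)
    (w : Coord m) (y : Coord n) : Coord m :=
  w - fderiv ℝ F y (sharp (pullbackForm G F) y ((G (F y) w).comp (fderiv ℝ F y)))

theorem apply_normalPart (hn : ∀ v, (∀ w, pullbackForm G F y v w = 0) → v = 0) (w : Coord m)
    (v : Coord n) : G (F y) (normalPart G F w y) (fderiv ℝ F y v) = 0 := by
  rw [normalPart, map_sub, sub_apply, ← pullbackForm_apply, apply_sharp hn]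
  simp

theorem normalPart_eq_self {w : Coord m} (hw : ∀ v, G (F y) w (fderiv ℝ F y v) = 0) :
    normalPart G F w y = w := by
  have : (G (F y) w).comp (fderiv ℝ F y) = 0 := by
    ext1 v
    exact hw v
  rw [normalPart, this, map_zero, map_zero, sub_zero]

/-- Inversion of linear maps is differentiable at an invertible one, and nondegeneracy makes the
induced metric invertible at `y`. -/
theorem differentiableAt_normalPart (hG : DifferentiableAt ℝ G (F y)) (hF : ContDiffAt ℝ 2 F y)
    (hn : ∀ v, (∀ w, pullbackForm G F y v w = 0) → v = 0) (w : Coord m) :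
    DifferentiableAt ℝ (normalPart G F w) y := by
  have hF' : DifferentiableAt ℝ F y := hF.differentiableAt (by norm_num)
  have hD := differentiableAt_fderiv hF
  have hGF : DifferentiableAt ℝ (fun x => G (F x)) y := hG.fun_comp' y hF'
  have hφ : DifferentiableAt ℝ (fun x => (G (F x) w).comp (fderiv ℝ F x)) y :=
    (hGF.clm_apply (differentiableAt_const w)).clm_comp hD
  have hinv : DifferentiableAt ℝ (fun x => sharp (pullbackForm G F) x) y :=
    DifferentiableAt.fun_comp' (g := ContinuousLinearMap.inverse) (f := pullbackForm G F) y
      ((isInvertible_of_nondegenerate hn).contDiffAt_map_inverse (n := 1)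
        |>.differentiableAt (by simp)) (differentiableAt_pullbackForm hG hF)
  exact (differentiableAt_const w).sub (hD.clm_apply (hinv.clm_apply hφ))

/-- The constant vectors `α`, `β` are projected to the normal planes, and the first is rescaled to
make the Gram determinant constant. Orthonormality away from `y` is not needed, so no Gram–Schmidt
process is involved. -/
theorem exists_isNormalFrameAt (hs : ∀ z v w, G z v w = G z w v)
    (hn : ∀ v, (∀ w, G (F y) v w = 0) → v = 0) (hG : DifferentiableAt ℝ G (F y))
    (hF : ContDiffAt ℝ 2 F y) (hinj : Function.Injective (fderiv ℝ F y))
    (hnd : ∀ᶠ x in nhds y, ∀ v, (∀ w, pullbackForm G F x v w = 0) → v = 0) {α β : Coord m}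
    (h : IsOrthonormalComplement (G (F y)) (fderiv ℝ F y) α β) :
    ∃ a b, IsNormalFrameAt G F y a b ∧ a y = α ∧ b y = β ∧ ∀ᶠ x in nhds y,
      (G (F x) (a x) (a x) * G (F x) (b x) (b x) - G (F x) (a x) (b x) ^ 2) ^ 2 = 1 := by
  set a := normalPart G F α
  set b := normalPart G F β
  have hF' : DifferentiableAt ℝ F y := hF.differentiableAt (by norm_num)
  have hGF : DifferentiableAt ℝ (fun x => G (F x)) y := hG.fun_comp' y hF'
  have ha : a y = α := normalPart_eq_self h.normal_left
  have hb : b y = β := normalPart_eq_self h.normal_right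
  have hda : DifferentiableAt ℝ a y := differentiableAt_normalPart hG hF hnd.self_of_nhds α
  have hdb : DifferentiableAt ℝ b y := differentiableAt_normalPart hG hF hnd.self_of_nhds β
  have hd : ∀ {s t : Coord n → Coord m}, DifferentiableAt ℝ s y → DifferentiableAt ℝ t y →
      DifferentiableAt ℝ (fun x => G (F x) (s x) (t x)) y := fun hs ht =>
    (hGF.clm_apply hs).clm_apply ht
  set ε := G (F y) α α * G (F y) β β with hε_def
  have hε : ε * ε = 1 := by
    linear_combination (G (F y) β β * G (F y) β β) * h.left_sq + h.right_sq
  -- The factor `ε = ±1` is the Gram determinant at `y`, so `q` equals `1` there and is positive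
  -- nearby. Dividing the first field by `√q` makes the Gram determinant constantly `ε`.
  set q : Coord n → ℝ := fun x =>
    ε * (G (F x) (a x) (a x) * G (F x) (b x) (b x) - G (F x) (a x) (b x) ^ 2) with hq_def
  have hdq : DifferentiableAt ℝ q y :=
    (((hd hda hda).fun_mul (hd hdb hdb)).fun_sub ((hd hda hdb).fun_pow 2)).const_mul ε
  have hqy : q y = 1 := by
    simp only [hq_def, ha, hb, h.inner_eq_zero, ← hε_def]
    linear_combination hε
  have hqpos : ∀ᶠ x in nhds y, 0 < q x :=
    hdq.continuousAt.eventually (by rw [hqy]; exact lt_mem_nhds one_pos)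
  have hgram : ∀ᶠ x in nhds y,
      G (F x) ((√(q x))⁻¹ • a x) ((√(q x))⁻¹ • a x) * G (F x) (b x) (b x) -
        G (F x) ((√(q x))⁻¹ • a x) (b x) ^ 2 = ε := by
    filter_upwards [hqpos] with x hx
    have h1 : (√(q x))⁻¹ ^ 2 * q x = 1 := by
      rw [inv_pow, Real.sq_sqrt hx.le, inv_mul_cancel₀ hx.ne']
    simp only [map_smul, smul_apply, smul_eq_mul]
    simp only [hq_def] at h1 ⊢
    linear_combination ε * h1 - (√(q x))⁻¹ ^ 2 * (G (F x) (a x) (a x) * G (F x) (b x) (b x) -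
      G (F x) (a x) (b x) ^ 2) * hε
  have hay : (√(q y))⁻¹ • a y = α := by simp [hqy, ha]
  refine ⟨fun x => (√(q x))⁻¹ • a x, b, ⟨hs, hn, hG, hF, hinj, ?_, hdb, ?_, ?_, ⟨ε, hgram⟩, ?_⟩,
    hay, hb, ?_⟩
  · exact ((hdq.sqrt (by simp [hqy])).inv (by simp [hqy])).smul hda
  · filter_upwards [hnd] with x hx v
    rw [map_smul, smul_apply, apply_normalPart hx, smul_zero]
  · filter_upwards [hnd] with x hx v
    exact apply_normalPart hx _ _
  · beta_reduce
    rwa [hay, hb]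
  · filter_upwards [hgram] with x hx
    rw [hx, sq, hε]

end SmoothFrame

/-! ### Coclosedness of the para-Hermitian form -/

section Neighborhoods

variable {n : ℕ} {M : Type*} [TopologicalSpace M] [ChartedSpace (Coord n) M]

theorem eventually_nhds_extChartAt {p : M} {P : Coord n → Prop}
    (hP : ∀ᶠ x in nhds p, P (extChartAt (𝓡 n) p x)) :
    ∀ᶠ y in nhds (extChartAt (𝓡 n) p p), P y := by
  have h1 : Filter.Tendsto (extChartAt (𝓡 n) p).symm (nhds (extChartAt (𝓡 n) p p)) (nhds p) := by
    have := continuousAt_extChartAt_symm (I := 𝓡 n) p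
    rwa [ContinuousAt, extChartAt_to_inv] at this
  filter_upwards [h1.eventually hP, extChartAt_target_mem_nhds (I := 𝓡 n) p] with y hy hyt
  rwa [(extChartAt (𝓡 n) p).right_inv hyt] at hy

end Neighborhoods

section Immersion

variable {M : Type*} [TopologicalSpace M] [ChartedSpace (Coord 6) M] [IsManifold (𝓡 6) ∞ M]
  {N : Type*} [TopologicalSpace N] [ChartedSpace (Coord 8) N] [IsManifold (𝓡 8) ∞ N]
  {h : PseudoRiemannianMetric 8 N} {f : M → N}

/-- The structure `L` is chosen separately at each point; this supplies a differentiable expression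
for `ω` near `p`. At each nearby point the chosen frame and the differentiable one are equally
oriented, so they have the same bivector. -/
theorem exists_normalFrame_form_eq (X : VectorCrossProduct 3 h) (oM : ManifoldOrientation 6 M)
    (oN : ManifoldOrientation 8 N) (hf : IsLorentzNormalImmersion h f) (p : M) :
    ∃ a b, IsNormalFrameAt (metricInChart h.val (f p)) (mapInCharts 6 8 f p)
        (extChartAt (𝓡 6) p p) a b ∧
      ∀ᶠ y in nhds (extChartAt (𝓡 6) p p), ∀ v w,
        formInChart (paraHermitianForm X oM oN hf) p y ![v, w] =
          -formInChart X.form (f p) (mapInCharts 6 8 f p y)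
            ![a y, b y, fderiv ℝ (mapInCharts 6 8 f p) y v,
              fderiv ℝ (mapInCharts 6 8 f p) y w] := by
  have hfc : ContinuousAt f p := hf.contMDiff.continuous.continuousAt
  have hx₀ := mem_chart_source (Coord 6) p
  have hfx₀ := mem_chart_source (Coord 8) (f p)
  have hsrc : ∀ᶠ x in nhds p, x ∈ (chartAt (Coord 6) p).source :=
    (chartAt (Coord 6) p).open_source.mem_nhds hx₀
  have hfsrc : ∀ᶠ x in nhds p, f x ∈ (chartAt (Coord 8) (f p)).source :=
    hfc.eventually ((chartAt (Coord 8) (f p)).open_source.mem_nhds hfx₀)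
  -- Fixed bases `e` and `E` of the coordinate spaces represent both orientations throughout a
  -- neighbourhood, so that one determinant function tests positivity at all nearby points.
  obtain ⟨o, ho⟩ := oM.locally_constant p
  obtain ⟨o', ho'⟩ := oN.locally_constant (f p)
  let e : Basis (Fin 6) ℝ (Coord 6) := o.someBasis (by simp)
  let E : Basis (Fin 8) ℝ (Coord 8) := o'.someBasis (by simp)
  have he : e.orientation = o := o.someBasis_orientation _
  have hE : E.orientation = o' := o'.someBasis_orientation _
  rw [← he] at ho
  rw [← hE] at ho'
  have hframe := eventually_nhds_extChartAt (p := p) (P := fun y => ∃ α β,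
      IsOrthonormalComplement (metricInChart h.val (f p) (mapInCharts 6 8 f p y))
        (fderiv ℝ (mapInCharts 6 8 f p) y) α β ∧
      0 < frameDet e E (fderiv ℝ (mapInCharts 6 8 f p) y) α β ∧
      ∀ v w, formInChart (paraHermitianForm X oM oN hf) p y ![v, w] =
        -formInChart X.form (f p) (mapInCharts 6 8 f p y)
          ![α, β, fderiv ℝ (mapInCharts 6 8 f p) y v, fderiv ℝ (mapInCharts 6 8 f p) y w]) <| by
    filter_upwards [hsrc, hfsrc, ho, hfc.eventually ho'] with x hx hfx hox hox'
    exact exists_frame_inCharts X oM oN hf hx hfx hox hox'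
  have hinj := eventually_nhds_extChartAt (p := p) (P := fun y =>
      Function.Injective (fderiv ℝ (mapInCharts 6 8 f p) y)) <| by
    filter_upwards [hsrc, hfsrc] with x hx hfx
    exact injective_fderiv_mapInCharts hf hx hfx
  set F := mapInCharts 6 8 f p
  set G := metricInChart h.val (f p)
  set y₀ := extChartAt (𝓡 6) p p
  have hs : ∀ z v w, G z v w = G z w v := fun z v w => h.symm _ _ _
  have hFy₀ : F y₀ = extChartAt (𝓡 8) (f p) (f p) := mapInCharts_extChartAt hx₀
  have hF : ContDiffAt ℝ 2 F y₀ := (contDiffAt_mapInCharts hf.contMDiff hx₀ hfx₀).of_le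
    ENat.LEInfty.out
  have hG : DifferentiableAt ℝ G (F y₀) := by
    rw [hFy₀]
    exact differentiableAt_metricInChart h (f p)
  have hn : ∀ v, (∀ w, G (F y₀) v w = 0) → v = 0 := by
    rw [hFy₀]
    exact metricInChart_nondegenerate h hfx₀
  have hnd : ∀ᶠ y in nhds y₀, ∀ v, (∀ w, pullbackForm G F y v w = 0) → v = 0 := by
    filter_upwards [hframe, hinj] with y ⟨α, β, hαβ, _, _⟩ hy
    exact hαβ.nondegenerate (hs _) hy
  -- The frame chosen at `p` itself is the seed of the differentiable frame, which is therefore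
  -- positive at `y₀` and, by continuity, near `y₀`.
  obtain ⟨α, β, hαβ, hpos, -⟩ := hframe.self_of_nhds
  obtain ⟨a, b, hab, rfl, rfl, hgram⟩ :=
    exists_isNormalFrameAt hs hn hG hF hinj.self_of_nhds hnd hαβ
  have hdet : ∀ᶠ y in nhds y₀, 0 < frameDet e E (fderiv ℝ F y) (a y) (b y) :=
    (continuousAt_frameDet (differentiableAt_fderiv hF).continuousAt
      hab.differentiableAt_left.continuousAt
      hab.differentiableAt_right.continuousAt).eventually (lt_mem_nhds hpos)
  refine ⟨a, b, hab, ?_⟩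
  filter_upwards [hframe, hgram, hdet, hab.normal_left, hab.normal_right]
    with y ⟨α, β, hαβ, hy, hform⟩ hgy hdy hay hby v w
  rw [hform, form_eq_of_frames (hs _) hαβ hay hby hgy hy hdy]

theorem isCoclosed_paraHermitianForm (X : VectorCrossProduct 3 h) (oM : ManifoldOrientation 6 M)
    (oN : ManifoldOrientation 8 N) (hf : IsLorentzNormalImmersion h f) (hX : X.IsSemiParallel) :
    IsCoclosed (pullbackMetric h f) (paraHermitianForm X oM oN hf) := by
  intro p v
  obtain ⟨a, b, hab, hform⟩ := exists_normalFrame_form_eq X oM oN hf p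
  have hfc : ContinuousAt f p := hf.contMDiff.continuous.continuousAt
  have hx₀ := mem_chart_source (Coord 6) p
  have hfx₀ := mem_chart_source (Coord 8) (f p)
  have hFy₀ := mapInCharts_extChartAt (f := f) hx₀
  have hmetric : metricInChart (pullbackMetric h f) p =ᶠ[nhds (extChartAt (𝓡 6) p p)]
      pullbackForm (metricInChart h.val (f p)) (mapInCharts 6 8 f p) := by
    refine eventually_nhds_extChartAt ?_
    filter_upwards [(chartAt (Coord 6) p).open_source.mem_nhds hx₀,
      hfc.eventually ((chartAt (Coord 8) (f p)).open_source.mem_nhds hfx₀)] with x hx hfx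
    exact metricInChart_pullbackMetric hf hx hfx
  have hA : DifferentiableAt ℝ (formInChart X.form (f p))
      (mapInCharts 6 8 f p (extChartAt (𝓡 6) p p)) := by
    rw [hFy₀]
    exact differentiableAt_formInChart X (f p)
  have key := hab.sum_covDeriv_form (formInChart X.form (f p)) hA
    (formInChart (paraHermitianForm X oM oN hf) p) hform (fun r s t => by
      rw [hFy₀]
      -- Semi-parallelism is applied to the tangent vectors with coordinates `r`, `s`, `t` in the
      -- preferred chart at `f p`.
      have hco := hX (f p) fun j => coordFrame (f p) (f p) (![r, s, t] j)
      simp only [codifferential, continuousLinearMapAt_coordFrame hfx₀] at hco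
      exact neg_eq_zero.1 hco)
    ((trivializationAt (Coord 6) (TangentSpace (𝓡 6)) p).continuousLinearMapAt ℝ p (v 0))
  rw [codifferential, neg_eq_zero]
  refine Eq.trans (Finset.sum_congr rfl fun i _ => ?_) key
  -- The covariant derivative and the inverse metric depend only on the germ of the metric, so the
  -- chart expression of the pullback metric may be replaced by `pullbackForm`.
  rw [covDeriv_congr hmetric, sharp, hmetric.eq_of_nhds]
  congr 1
  funext j
  fin_cases j <;> rfl

end Immersion

end ParaGray

end

theorem mainTheorem12
    {M : Type*} [TopologicalSpace M] [ChartedSpace (EuclideanSpace ℝ (Fin 6)) M]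
    [IsManifold (𝓡 6) ∞ M] (oM : ParaGray.ManifoldOrientation 6 M)
    {N : Type*} [TopologicalSpace N] [ChartedSpace (EuclideanSpace ℝ (Fin 8)) N]
    [IsManifold (𝓡 8) ∞ N] (oN : ParaGray.ManifoldOrientation 8 N)
    (h : ParaGray.PseudoRiemannianMetric 8 N)
    (hsig : ∀ x : N, ParaGray.HasSignature (h.bilin x) 4 4)
    (X : ParaGray.VectorCrossProduct 3 h)
    (f : M → N) (hf : ParaGray.IsLorentzNormalImmersion h f)
    (hX : X.IsSemiParallel) :
    ParaGray.IsCoclosed (ParaGray.pullbackMetric h f)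
      (ParaGray.paraHermitianForm X oM oN hf) := by
  exact ParaGray.isCoclosed_paraHermitianForm X oM oN hf hX
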